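/- Let $R$ be the root system of type $E_7$, with simple roots $\alpha_1,\dots,\alpha_7$ labelled as in Bourbaki, highest root $\tilde\alpha=2\alpha_1+2\alpha_2+3\alpha_3+4\alpha_4+3\alpha_5+2\alpha_6+\alpha_7$ and Weyl group $W$ generated by the simple reflections $s_1,\dots,s_7$. Consider the root datum with $X^*=Q(R)$ (the root lattice) and $X_*=P(R^\vee)$ (the coweight lattice), put $V=X_*\otimes\mathbb{R}$, and let $\rho_1,\dots,\rho_7\in X_*$ be the basis of $V$ dual to $\alpha_1,\dots,\alpha_7$. Let $W_a=Q(R^\vee)\rtimes W$ be the affine Weyl group and $\widetilde W=X_*\rtimes W$ the extended affine Weyl group, both acting on $V$ by affine maps, and write $t_\nu$ for the translation by $\nu\in X_*$. Let $\mathfrak A=\{v\in V : \langle\alpha_i,v\rangle>0 \text{ for } i=1,\dots,7,\ \langle\tilde\alpha,v\rangle<1\}$ be the base alcove and $\Omega$ its stabilizer in $\widetilde W$, so that every element of $\widetilde W$ can be written uniquely as $y\omega$ with $y\in W_a$, $\omega\in\Omega$. The Bruhat order on $W_a$ (with respect to the reflections in the walls of $\mathfrak A$) is extended to $\widetilde W$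 by: $y\omega\le y'\omega'$ if and only if $\omega=\omega'$ and $y\le y'$. For $\mu\in X_*$ let $\operatorname{Adm}(\mu)$ (the $\mu$-admissible elements) be the set of $x\in\widetilde W$ with $x\le t_{w(\mu)}$ for some $w\in W$, and let $\operatorname{Perm}(\mu)$ (the $\mu$-permissible elements) be the set of $x\in\widetilde W$ such that $x$ and $t_\mu$ have the same $\Omega$-component and $x(v)-v$ lies in the convex hull of the orbit $W\mu$ for every $v\in\overline{\mathfrak A}$. A coweight $\mu\in X_*$ is minuscule if $\langle\alpha,\mu\rangle\in\{-1,0,1\}$ for all $\alpha\in R$, dominant if $\langle\alpha_i,\mu\rangle\ge 0$ for all $i$, and nontrivial if $\mu\neq 0$. Then: 1. $\rho_7$ is the unique nontrivial dominant minuscule coweight of $E_7$. 2. Let $\mu=\rho_7$, $w_1=s_2s_4s_5s_3s_4s_1s_3s_2s_4s_5s_6s_7$, $w_2=s_4s_3s_2s_4s_1s_3$, and $x=w_2\,t_\mu\,w_1^{-1}\in\widetilde W$. Then $x\in\operatorname{Perm}(\mu)$ and $x\notin\operatorname{Adm}(\mu)$. 3. $\operatorname{Adm}(\mu)\neq\operatorname{Perm}(\mu)$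 for every nontrivial minuscule coweight $\mu\in P(R^\vee)$ of $E_7$. -/

import Mathlib

open scoped Matrix

/-! ### The Bruhat order of a Coxeter group, given by its set `S` of simple reflections -/

namespace Coxeter

/-- Length of `g` with respect to a set `S` of involutions generating a group:
the least length of a word in `S` with product `g`. -/
noncomputable def length {G : Type*} [Group G] (S : Set G) (g : G) : ℕ :=
  sInf {n : ℕ | ∃ l : List G, (∀ s ∈ l, s ∈ S) ∧ l.prod = g ∧ l.length = n}

/-- Reflections: the conjugates of the simple reflections in the group generated by `S`. -/
def IsReflection {G : Type*} [Group G] (S : Set G) (t : G) : Prop :=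
  ∃ g ∈ Subgroup.closure S, ∃ s ∈ S, t = g * s * g⁻¹

/-- The (strong) Bruhat order on the group generated by `S`: the reflexive transitive closure of
`a < t a`, where `t` is a reflection and `ℓ(a) < ℓ(t a)`. -/
def BruhatLE {G : Type*} [Group G] (S : Set G) : G → G → Prop :=
  Relation.ReflTransGen fun a b =>
    ∃ t, IsReflection S t ∧ b = t * a ∧ length S a < length S b

end Coxeter

/-! ### Extended affine Weyl groups

Throughout, `P` is a root system in `U`, with coroots in the dual space `V`.  It determines the
root datum `(Q(R), P(R^∨), R, R^∨)`: here `X^* = Q(R)` is the root lattice in `U`, and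
`X_* = P(R^∨)`, the lattice of coweights, is the dual lattice in `V = X_* ⊗ ℝ`.
The family `α` is the chosen base of simple roots, and `θ` is the highest root. -/

namespace AffineWeyl

section

variable {ι κ U V : Type*} [AddCommGroup U] [Module ℝ U] [AddCommGroup V] [Module ℝ V]

/-- The finite Weyl group `W`, acting on `V`; it is generated by the reflections
`v ↦ v - ⟨β, v⟩ β^∨`. -/
def finiteWeyl (P : RootPairing ι ℝ U V) : Subgroup (V ≃ₗ[ℝ] V) :=
  Subgroup.closure (Set.range P.coreflection)

/-- The coweight lattice `P(R^∨)`, which is the group of cocharacters `X_*`. -/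
def coweightLattice (P : RootPairing ι ℝ U V) : AddSubgroup V where
  carrier := {v | ∀ i, ∃ n : ℤ, P.root' i v = n}
  zero_mem' i := ⟨0, by simp⟩
  add_mem' {v w} hv hw i := by
    obtain ⟨m, hm⟩ := hv i
    obtain ⟨n, hn⟩ := hw i
    exact ⟨m + n, by rw [map_add, hm, hn]; push_cast; rfl⟩
  neg_mem' {v} hv i := by
    obtain ⟨m, hm⟩ := hv i
    exact ⟨-m, by rw [map_neg, hm]; push_cast; rfl⟩

/-- The coroot lattice `Q(R^∨)`. -/
def corootLattice (P : RootPairing ι ℝ U V) : AddSubgroup V :=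
  AddSubgroup.closure (Set.range P.coroot)

theorem finiteWeyl_stable (P : RootPairing ι ℝ U V) (L : AddSubgroup V)
    (h : ∀ i, ∀ v ∈ L, P.coreflection i v ∈ L) :
    ∀ w ∈ finiteWeyl P, ∀ v ∈ L, w v ∈ L := by
  intro w hw
  induction hw using Subgroup.closure_induction'' with
  | one => exact fun v hv => hv
  | mem x hx =>
    obtain ⟨i, rfl⟩ := hx
    exact h i
  | inv_mem x hx =>
    obtain ⟨i, rfl⟩ := hx
    rw [P.coreflection_inv]
    exact h i
  | mul x y _ _ hx hy => exact fun v hv => hx _ (hy v hv)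

theorem coweightLattice_stable (P : RootPairing ι ℝ U V) :
    ∀ w ∈ finiteWeyl P, ∀ v ∈ coweightLattice P, w v ∈ coweightLattice P := by
  refine finiteWeyl_stable P _ fun i v hv j => ?_
  obtain ⟨n, hn⟩ := hv (P.reflectionPerm i j)
  refine ⟨n, hn ▸ ?_⟩
  simp [RootPairing.root', RootPairing.root_reflectionPerm, RootPairing.reflection_apply,
    RootPairing.coreflection_apply, mul_comm]

theorem corootLattice_stable (P : RootPairing ι ℝ U V) :
    ∀ w ∈ finiteWeyl P, ∀ v ∈ corootLattice P, w v ∈ corootLattice P := by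
  refine finiteWeyl_stable P _ fun i v hv => ?_
  induction hv using AddSubgroup.closure_induction with
  | mem x hx =>
    obtain ⟨j, rfl⟩ := hx
    rw [← P.coroot_reflectionPerm]
    exact AddSubgroup.subset_closure ⟨_, rfl⟩
  | zero => simp
  | add x y _ _ hx hy => simpa using AddSubgroup.add_mem _ hx hy
  | neg x _ hx => simpa using AddSubgroup.neg_mem _ hx

/-- The group `L ⋊ W` of all affine maps `v ↦ w v + ν` with `w ∈ W` and `ν ∈ L`, where `L` is a
lattice in `V` stable under `W`. -/
def semidirect (P : RootPairing ι ℝ U V) (L : AddSubgroup V)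
    (hL : ∀ w ∈ finiteWeyl P, ∀ v ∈ L, w v ∈ L) : Subgroup (V ≃ᵃ[ℝ] V) where
  carrier := {x | x.linear ∈ finiteWeyl P ∧ x 0 ∈ L}
  one_mem' := ⟨(finiteWeyl P).one_mem, L.zero_mem⟩
  mul_mem' {x y} hx hy := by
    refine ⟨(finiteWeyl P).mul_mem hx.1 hy.1, ?_⟩
    have h : (x * y) 0 = x.linear (y 0) + x 0 := by
      have := x.map_vadd 0 (y 0)
      simpa using this
    rw [h]
    exact L.add_mem (hL _ hx.1 _ hy.2) hx.2
  inv_mem' {x} hx := by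
    have h1 : (x⁻¹).linear ∈ finiteWeyl P := (finiteWeyl P).inv_mem hx.1
    refine ⟨h1, ?_⟩
    have h : x⁻¹ 0 = - (x⁻¹).linear (x 0) := by
      have h2 := (x⁻¹).map_vadd 0 (x 0)
      have h3 : x⁻¹ (x 0) = 0 := x.symm_apply_apply 0
      simp only [vadd_eq_add, add_zero, h3] at h2
      exact (neg_eq_of_add_eq_zero_right h2.symm).symm
    rw [h]
    exact L.neg_mem (hL _ h1 _ hx.2)

/-- The affine Weyl group `W_a = Q(R^∨) ⋊ W`. -/
def affineWeyl (P : RootPairing ι ℝ U V) : Subgroup (V ≃ᵃ[ℝ] V) :=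
  semidirect P (corootLattice P) (corootLattice_stable P)

/-- The extended affine Weyl group `X_* ⋊ W = P(R^∨) ⋊ W`. -/
def extAffineWeyl (P : RootPairing ι ℝ U V) : Subgroup (V ≃ᵃ[ℝ] V) :=
  semidirect P (coweightLattice P) (coweightLattice_stable P)

/-- The translation `t_ν : v ↦ v + ν`. -/
def trans (ν : V) : V ≃ᵃ[ℝ] V := AffineEquiv.constVAdd ℝ V ν

/-- The linear reflection `s_β`, as an affine map. -/
def refl (P : RootPairing ι ℝ U V) (i : ι) : V ≃ᵃ[ℝ] V := (P.coreflection i).toAffineEquiv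

/-- The simple affine reflections, that is, the reflections in the walls of the base alcove:
`s_i` for the simple roots, and `s_0 = t_{θ^∨} s_θ`, which is `v ↦ v - (⟨θ, v⟩ - 1) θ^∨`. -/
def simpleAffine (P : RootPairing ι ℝ U V) (α : κ → ι) (θ : ι) : Set (V ≃ᵃ[ℝ] V) :=
  Set.range (fun k => refl P (α k)) ∪ {trans (P.coroot θ) * refl P θ}

/-- The base alcove. -/
def alcove (P : RootPairing ι ℝ U V) (α : κ → ι) (θ : ι) : Set V :=
  {v | (∀ k, 0 < P.root' (α k) v) ∧ P.root' θ v < 1}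

/-- The stabilizer `Ω` of the base alcove in the extended affine Weyl group. -/
def Omega (P : RootPairing ι ℝ U V) (α : κ → ι) (θ : ι) : Set (V ≃ᵃ[ℝ] V) :=
  {x | x ∈ extAffineWeyl P ∧ x '' alcove P α θ = alcove P α θ}

/-- The Bruhat order on the extended affine Weyl group: `y ω ≤ y' ω'` if and only if `ω = ω'` and
`y ≤ y'` in `W_a`, for `y, y' ∈ W_a` and `ω, ω' ∈ Ω`. -/
def ExtBruhatLE (P : RootPairing ι ℝ U V) (α : κ → ι) (θ : ι) (x x' : V ≃ᵃ[ℝ] V) : Prop :=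
  ∃ ω ∈ Omega P α θ, ∃ y ∈ affineWeyl P, ∃ y' ∈ affineWeyl P,
    x = y * ω ∧ x' = y' * ω ∧ Coxeter.BruhatLE (simpleAffine P α θ) y y'

/-- The orbit `W μ`. -/
def orbit (P : RootPairing ι ℝ U V) (μ : V) : Set V := {v | ∃ w ∈ finiteWeyl P, v = w μ}

/-- The `μ`-admissible set. -/
def Adm (P : RootPairing ι ℝ U V) (α : κ → ι) (θ : ι) (μ : V) : Set (V ≃ᵃ[ℝ] V) :=
  {x | x ∈ extAffineWeyl P ∧ ∃ w ∈ finiteWeyl P, ExtBruhatLE P α θ x (trans (w μ))}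

/-- The `μ`-permissible set: `x` and `t_μ` have the same component in `Ω` (with respect to the
decomposition of the extended affine Weyl group as `W_a Ω`), and `x v - v` lies in the convex hull
of `W μ` for all `v` in the closed base alcove. -/
def Perm [TopologicalSpace V] (P : RootPairing ι ℝ U V) (α : κ → ι) (θ : ι) (μ : V) :
    Set (V ≃ᵃ[ℝ] V) :=
  {x | x ∈ extAffineWeyl P ∧
    (∃ ω ∈ Omega P α θ, ∃ y₁ ∈ affineWeyl P, ∃ y₂ ∈ affineWeyl P,
      x = y₁ * ω ∧ trans μ = y₂ * ω) ∧
    ∀ v ∈ closure (alcove P α θ), x v - v ∈ convexHull ℝ (orbit P μ)}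

def IsMinuscule (P : RootPairing ι ℝ U V) (μ : V) : Prop :=
  ∀ i, P.root' i μ = -1 ∨ P.root' i μ = 0 ∨ P.root' i μ = 1

def IsDominant (P : RootPairing ι ℝ U V) (α : κ → ι) (μ : V) : Prop :=
  ∀ k, 0 ≤ P.root' (α k) μ

end

end AffineWeyl

/-! ### The root system `E₇`

`U = ℝ⁷` has the basis of simple roots `α₁, …, α₇` (labelled as in Bourbaki), and `V = ℝ⁷` has the
dual basis of fundamental coweights `ρ₁, …, ρ₇`; the pairing is the dot product.  The roots are the
vectors obtained from the simple roots by repeatedly applying simple reflections.  In type `E₇` the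
coroot of `r = ∑ cⱼ αⱼ` is `∑ cⱼ αⱼ^∨`, and `αⱼ^∨ = ∑ᵢ ⟨αᵢ, αⱼ^∨⟩ ρᵢ` is given by the `j`-th column
of the Cartan matrix.  All indices are shifted by one: `αᵢ` has the index `i - 1` in `Fin 7`. -/

namespace E7

/-- `⟨x, r^∨⟩` for `x` and `r` in the root lattice, in coordinates with respect to the simple
roots. -/
def form (x r : Fin 7 → ℤ) : ℤ := x ⬝ᵥ (CartanMatrix.E₇ *ᵥ r)

/-- The reflection `x ↦ x - ⟨x, r^∨⟩ r` on the root lattice. -/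
def reflect (r x : Fin 7 → ℤ) : Fin 7 → ℤ := x - form x r • r

/-- The roots, in coordinates with respect to the simple roots. -/
inductive IsRoot : (Fin 7 → ℤ) → Prop
  | simple (i : Fin 7) : IsRoot (Pi.single i 1)
  | reflect (i : Fin 7) (r : Fin 7 → ℤ) : IsRoot r → IsRoot (reflect (Pi.single i 1) r)

theorem form_comm (x y : Fin 7 → ℤ) : form x y = form y x := by
  rw [form, form, Matrix.dotProduct_mulVec, ← Matrix.mulVec_transpose, CartanMatrix.E₇_transpose,
    dotProduct_comm]

theorem form_sub_left (x y z : Fin 7 → ℤ) : form (x - y) z = form x z - form y z := by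
  simp [form, sub_dotProduct]

theorem form_smul_left (c : ℤ) (x z : Fin 7 → ℤ) : form (c • x) z = c * form x z := by
  rw [form, form, smul_dotProduct, smul_eq_mul]

theorem form_sub_right (x y z : Fin 7 → ℤ) : form x (y - z) = form x y - form x z := by
  rw [form_comm, form_sub_left, form_comm y, form_comm z]

theorem form_smul_right (c : ℤ) (x z : Fin 7 → ℤ) : form x (c • z) = c * form x z := by
  rw [form_comm, form_smul_left, form_comm]

theorem form_single (i : Fin 7) : form (Pi.single i 1) (Pi.single i 1) = 2 := by
  simp [form]

theorem form_reflect (r x y : Fin 7 → ℤ) (h : form r r = 2) :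
    form (reflect r x) (reflect r y) = form x y := by
  simp only [reflect, form_sub_left, form_sub_right, form_smul_left, form_smul_right, h,
    form_comm r y]
  ring

theorem reflect_reflect (r x : Fin 7 → ℤ) (h : form r r = 2) : reflect r (reflect r x) = x := by
  simp only [reflect, form_sub_left, form_smul_left, h]
  module

theorem IsRoot.form_self {r : Fin 7 → ℤ} (h : IsRoot r) : form r r = 2 := by
  induction h with
  | simple i => exact form_single i
  | reflect i r _ ih => rw [form_reflect _ _ _ (form_single i), ih]

theorem IsRoot.reflect_mem {r : Fin 7 → ℤ} (hr : IsRoot r) :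
    ∀ x, IsRoot x → IsRoot (E7.reflect r x) := by
  induction hr with
  | simple i => exact fun x hx => .reflect i x hx
  | reflect i r _ ih =>
    intro x hx
    have hi := form_single i
    have key : E7.reflect (E7.reflect (Pi.single i 1) r) x =
        E7.reflect (Pi.single i 1) (E7.reflect r (E7.reflect (Pi.single i 1) x)) := by
      have h1 : form x (E7.reflect (Pi.single i 1) r) =
          form (E7.reflect (Pi.single i 1) x) r := by
        rw [← form_reflect _ _ _ hi, reflect_reflect _ _ hi]
      rw [show E7.reflect (E7.reflect (Pi.single i 1) r) x = x -
        form x (E7.reflect (Pi.single i 1) r) • E7.reflect (Pi.single i 1) r from rfl, h1,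
        show E7.reflect r (E7.reflect (Pi.single i 1) x) = E7.reflect (Pi.single i 1) x -
          form (E7.reflect (Pi.single i 1) x) r • r from rfl]
      generalize form (E7.reflect (Pi.single i 1) x) r = c
      have h2 := reflect_reflect _ x hi
      rw [show E7.reflect (Pi.single i 1) (E7.reflect (Pi.single i 1) x - c • r) =
        E7.reflect (Pi.single i 1) (E7.reflect (Pi.single i 1) x) -
          c • E7.reflect (Pi.single i 1) r by
        simp only [E7.reflect, form_sub_left, form_smul_left]; module, h2]
    rw [key]
    exact .reflect i _ (ih _ (.reflect i x hx))

/-- The index type of the set of roots. -/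
abbrev Root : Type := {r : Fin 7 → ℤ // IsRoot r}

instance dotProduct_isPerfPair :
    (dotProductBilin ℝ ℝ : (Fin 7 → ℝ) →ₗ[ℝ] (Fin 7 → ℝ) →ₗ[ℝ] ℝ).IsPerfPair := by
  refine .of_injective ?_ ?_
  · intro x y h
    exact dotProduct_eq _ _ fun u => LinearMap.congr_fun h u
  · intro x y h
    refine dotProduct_eq _ _ fun u => ?_
    rw [dotProduct_comm x, dotProduct_comm y]
    exact LinearMap.congr_fun h u

theorem cast_dotProduct (x r : Fin 7 → ℤ) :
    (fun j => (x j : ℝ)) ⬝ᵥ (fun j => ((CartanMatrix.E₇ *ᵥ r) j : ℝ)) = (form x r : ℝ) := by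
  simp [form, dotProduct]

/-- The root system `E₇`. -/
noncomputable def rootSystem : RootPairing Root ℝ (Fin 7 → ℝ) (Fin 7 → ℝ) where
  toLinearMap := dotProductBilin ℝ ℝ
  root := ⟨fun r j => (r.1 j : ℝ), fun r s h => Subtype.ext <| funext fun j => by
    simpa using congrFun h j⟩
  coroot := ⟨fun r j => ((CartanMatrix.E₇ *ᵥ r.1) j : ℝ), fun r s h => Subtype.ext <| by
    have h1 : CartanMatrix.E₇ *ᵥ r.1 = CartanMatrix.E₇ *ᵥ s.1 := funext fun j => by
      simpa using congrFun h j
    refine Matrix.mulVec_injective_of_det_ne_zero ?_ h1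
    rw [CartanMatrix.E₇_det]; norm_num⟩
  root_coroot_two r := by
    refine (cast_dotProduct r.1 r.1).trans ?_
    rw [r.2.form_self]; norm_num
  reflectionPerm r :=
    { toFun := fun x => ⟨reflect r.1 x.1, r.2.reflect_mem _ x.2⟩
      invFun := fun x => ⟨reflect r.1 x.1, r.2.reflect_mem _ x.2⟩
      left_inv := fun x => Subtype.ext (reflect_reflect _ _ r.2.form_self)
      right_inv := fun x => Subtype.ext (reflect_reflect _ _ r.2.form_self) }
  reflectionPerm_root r x := by
    have h : (dotProductBilin ℝ ℝ) (fun j => (x.1 j : ℝ))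
      (fun j => ((CartanMatrix.E₇ *ᵥ r.1) j : ℝ)) = (form x.1 r.1 : ℝ) := cast_dotProduct x.1 r.1
    change (fun j => (x.1 j : ℝ)) - _ • (fun j => (r.1 j : ℝ)) = fun j => (reflect r.1 x.1 j : ℝ)
    erw [h]
    funext j
    simp [reflect]
  reflectionPerm_coroot r x := by
    have h : (dotProductBilin ℝ ℝ) (fun j => (r.1 j : ℝ))
      (fun j => ((CartanMatrix.E₇ *ᵥ x.1) j : ℝ)) = (form x.1 r.1 : ℝ) := by
      rw [form_comm]; exact cast_dotProduct r.1 x.1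
    change (fun j => ((CartanMatrix.E₇ *ᵥ x.1) j : ℝ)) - _ •
      (fun j => ((CartanMatrix.E₇ *ᵥ r.1) j : ℝ)) =
      fun j => ((CartanMatrix.E₇ *ᵥ (reflect r.1 x.1)) j : ℝ)
    erw [h]
    funext j
    rw [reflect, Matrix.mulVec_sub, Matrix.mulVec_smul]
    simp only [Pi.sub_apply, Pi.smul_apply, smul_eq_mul, Int.cast_sub, Int.cast_mul]

/-- The base of simple roots. -/
def simpleRoot (i : Fin 7) : Root := ⟨Pi.single i 1, .simple i⟩

theorem isRoot_highest : IsRoot ![2, 2, 3, 4, 3, 2, 1] := by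
  have h := IsRoot.simple 0
  have h := h.reflect 2
  have h := h.reflect 3
  have h := h.reflect 1
  have h := h.reflect 4
  have h := h.reflect 3
  have h := h.reflect 2
  have h := h.reflect 5
  have h := h.reflect 4
  have h := h.reflect 3
  have h := h.reflect 1
  have h := h.reflect 6
  have h := h.reflect 5
  have h := h.reflect 4
  have h := h.reflect 3
  have h := h.reflect 2
  have h := h.reflect 0
  convert h using 1
  decide

/-- The highest root `2α₁ + 2α₂ + 3α₃ + 4α₄ + 3α₅ + 2α₆ + α₇`. -/
def highestRoot : Root := ⟨![2, 2, 3, 4, 3, 2, 1], isRoot_highest⟩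

/-- The fundamental coweight `ρ₇`. -/
def rho7 : Fin 7 → ℝ := Pi.single 6 1

/-- The simple reflection `s_i`, for `i = 1, …, 7`. -/
noncomputable def s (i : ℕ) : (Fin 7 → ℝ) ≃ᵃ[ℝ] (Fin 7 → ℝ) :=
  AffineWeyl.refl rootSystem (simpleRoot (Fin.ofNat 7 (i - 1)))

noncomputable def w₁ : (Fin 7 → ℝ) ≃ᵃ[ℝ] (Fin 7 → ℝ) :=
  s 2 * s 4 * s 5 * s 3 * s 4 * s 1 * s 3 * s 2 * s 4 * s 5 * s 6 * s 7

noncomputable def w₂ : (Fin 7 → ℝ) ≃ᵃ[ℝ] (Fin 7 → ℝ) :=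
  s 4 * s 3 * s 2 * s 4 * s 1 * s 3

/-- The element `x = w₂ t_μ w₁⁻¹` for `μ = ρ₇`. -/
noncomputable def x : (Fin 7 → ℝ) ≃ᵃ[ℝ] (Fin 7 → ℝ) := w₂ * AffineWeyl.trans rho7 * w₁⁻¹

/-- The set `Adm(μ)` for the root datum `(Q(R), P(R^∨))` with `R = E₇`. -/
def Adm (μ : Fin 7 → ℝ) : Set ((Fin 7 → ℝ) ≃ᵃ[ℝ] (Fin 7 → ℝ)) :=
  AffineWeyl.Adm rootSystem simpleRoot highestRoot μ

/-- The set `Perm(μ)` for the root datum `(Q(R), P(R^∨))` with `R = E₇`. -/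
def Perm (μ : Fin 7 → ℝ) : Set ((Fin 7 → ℝ) ≃ᵃ[ℝ] (Fin 7 → ℝ)) :=
  AffineWeyl.Perm rootSystem simpleRoot highestRoot μ

end E7

namespace E7

/-! ### A certificate in natural numbers

The kernel evaluates the definitions of this section, so vectors are tuples of natural numbers. -/

/-! Put v₀ = ρ^∨/18 (`basePoint`), where 18 is the Coxeter number. The points 18 z(v₀), for z in the
extended affine Weyl group, are integral, and the Bruhat order is studied through them. By the
exchange condition (`exists_word_of_separates`), a reflection can raise the length of an element
only if its wall does not separate v₀ from the image of v₀ (`wall_mul_wall_pos`). A Bruhat chain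
therefore becomes a chain of `UpStep`s between integral points; the factor in Ω is harmless, since
it keeps v₀ inside the base alcove.

Non-admissibility. If x ≤ t_{w(μ)}, such a chain leads from 18 x(v₀) to 18 (v₀ + w(μ)). The endpoint
lies in the polytope `InHull` because w(μ) is minuscule, and the start of an upward step lies in the
polytope whenever its end does (`UpStep.inHull`), so the whole chain stays inside. The finite list
`upperPoints` contains 18 x(v₀), is closed under upward steps that stay in the polytope
(`IsUpper.step`), and contains no point 18 (v₀ + l) with l integral. This is a contradiction.

Permissibility. The map x is explicit, and x(v) - v is a combination of eight points of Wμ whose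
coefficients are affine functions of v, nonnegative on the closed alcove and of sum 1
(`x_sub_mem_convexHull`). The Ω-component is found with an explicit involution `omega`.

Other coweights. In the highest root only α₇ has coefficient 1, so ρ₇ is the only nontrivial
dominant minuscule coweight. Every nontrivial minuscule coweight is conjugate to it, and both sets
depend only on the Weyl orbit. -/

/-- A vector with seven natural coordinates. -/
structure NatVec where
  (a b c d e f g : ℕ)

namespace NatVec

/-- The dot product. -/
def dot (r p : NatVec) : ℕ :=
  Nat.add (Nat.mul r.a p.a) (Nat.add (Nat.mul r.b p.b) (Nat.add (Nat.mul r.c p.c)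
    (Nat.add (Nat.mul r.d p.d) (Nat.add (Nat.mul r.e p.e) (Nat.add (Nat.mul r.f p.f)
      (Nat.mul r.g p.g))))))

/-- The sum of the coordinates. -/
def height (r : NatVec) : ℕ := r.a + r.b + r.c + r.d + r.e + r.f + r.g

/-- The vector `p - c r^∨`, where `r` is a root. -/
def subCoroot (p r : NatVec) (c : ℕ) : NatVec where
  a := Nat.sub (Nat.add p.a (Nat.mul c r.c)) (Nat.mul c (Nat.mul 2 r.a))
  b := Nat.sub (Nat.add p.b (Nat.mul c r.d)) (Nat.mul c (Nat.mul 2 r.b))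
  c := Nat.sub (Nat.add p.c (Nat.mul c (Nat.add r.a r.d))) (Nat.mul c (Nat.mul 2 r.c))
  d := Nat.sub (Nat.add p.d (Nat.mul c (Nat.add (Nat.add r.b r.c) r.e))) (Nat.mul c (Nat.mul 2 r.d))
  e := Nat.sub (Nat.add p.e (Nat.mul c (Nat.add r.d r.f))) (Nat.mul c (Nat.mul 2 r.e))
  f := Nat.sub (Nat.add p.f (Nat.mul c (Nat.add r.e r.g))) (Nat.mul c (Nat.mul 2 r.f))
  g := Nat.sub (Nat.add p.g (Nat.mul c r.f)) (Nat.mul c (Nat.mul 2 r.g))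

/-- The vector `p + c r^∨`, where `r` is a root. -/
def addCoroot (p r : NatVec) (c : ℕ) : NatVec where
  a := Nat.sub (Nat.add p.a (Nat.mul c (Nat.mul 2 r.a))) (Nat.mul c r.c)
  b := Nat.sub (Nat.add p.b (Nat.mul c (Nat.mul 2 r.b))) (Nat.mul c r.d)
  c := Nat.sub (Nat.add p.c (Nat.mul c (Nat.mul 2 r.c))) (Nat.mul c (Nat.add r.a r.d))
  d := Nat.sub (Nat.add p.d (Nat.mul c (Nat.mul 2 r.d))) (Nat.mul c (Nat.add (Nat.add r.b r.c) r.e))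
  e := Nat.sub (Nat.add p.e (Nat.mul c (Nat.mul 2 r.e))) (Nat.mul c (Nat.add r.d r.f))
  f := Nat.sub (Nat.add p.f (Nat.mul c (Nat.mul 2 r.f))) (Nat.mul c (Nat.add r.e r.g))
  g := Nat.sub (Nat.add p.g (Nat.mul c (Nat.mul 2 r.g))) (Nat.mul c r.f)

/-- Equality test. -/
def beq (p q : NatVec) : Bool :=
  p.a.beq q.a && (p.b.beq q.b && (p.c.beq q.c && (p.d.beq q.d && (p.e.beq q.e &&
    (p.f.beq q.f && p.g.beq q.g)))))

/-- The root with the given coefficients. -/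
def toRoot (r : NatVec) : Fin 7 → ℤ := ![r.a, r.b, r.c, r.d, r.e, r.f, r.g]

/-- The point of `V` encoded by a vector, with coordinates shifted by `64`. -/
def toPoint (p : NatVec) : Fin 7 → ℤ :=
  ![p.a - 64, p.b - 64, p.c - 64, p.d - 64, p.e - 64, p.f - 64, p.g - 64]

/-- The simple reflections on the roots. -/
def simpleReflect (r : NatVec) : Fin 7 → NatVec :=
  ![{ r with a := r.c - r.a }, { r with b := r.d - r.b }, { r with c := r.a + r.d - r.c },
    { r with d := r.b + r.c + r.e - r.d }, { r with e := r.d + r.f - r.e },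
    { r with f := r.e + r.g - r.f }, { r with g := r.f - r.g }]

/-- The simple roots. -/
def simple : Fin 7 → NatVec :=
  ![⟨1,0,0,0,0,0,0⟩, ⟨0,1,0,0,0,0,0⟩, ⟨0,0,1,0,0,0,0⟩, ⟨0,0,0,1,0,0,0⟩, ⟨0,0,0,0,1,0,0⟩,
    ⟨0,0,0,0,0,1,0⟩, ⟨0,0,0,0,0,0,1⟩]

/-- The nonnegativity that makes `simpleReflect` a reflection. -/
def simpleReflectLE (r : NatVec) : Fin 7 → Bool :=
  ![r.a.ble r.c, r.b.ble r.d, r.c.ble (r.a + r.d), r.d.ble (r.b + r.c + r.e), r.e.ble (r.d + r.f),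
    r.f.ble (r.e + r.g), r.g.ble r.f]

theorem eq_of_beq {p q : NatVec} (h : p.beq q = true) : p = q := by
  cases p; cases q
  simpa [beq] using h

end NatVec

/-- The positive roots. -/
def posRoots : List NatVec :=
  [⟨1,1,2,3,3,2,1⟩, ⟨0,1,1,2,2,2,1⟩, ⟨1,2,2,3,3,2,1⟩, ⟨1,1,1,2,2,2,1⟩,
   ⟨1,1,2,2,2,1,1⟩, ⟨1,1,2,2,2,1,0⟩, ⟨1,1,1,2,2,1,1⟩, ⟨1,1,2,2,2,2,1⟩,
   ⟨1,1,2,3,2,2,1⟩, ⟨0,1,1,2,2,1,1⟩, ⟨1,1,1,2,2,1,0⟩, ⟨0,1,1,2,2,1,0⟩,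
   ⟨1,1,2,2,1,1,1⟩, ⟨1,1,2,3,2,1,0⟩, ⟨1,1,2,3,2,1,1⟩, ⟨1,2,2,3,2,2,1⟩,
   ⟨0,0,0,0,1,1,0⟩, ⟨1,1,2,2,1,1,0⟩, ⟨1,1,1,2,1,1,1⟩, ⟨1,1,1,2,1,1,0⟩,
   ⟨0,0,0,0,1,1,1⟩, ⟨0,1,1,2,1,1,1⟩, ⟨0,1,1,2,1,1,0⟩, ⟨0,0,0,0,0,1,1⟩,
   ⟨0,0,0,0,0,1,0⟩, ⟨0,0,0,0,1,0,0⟩, ⟨1,2,3,4,3,2,1⟩, ⟨2,2,3,4,3,2,1⟩,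
   ⟨1,2,2,4,3,2,1⟩, ⟨1,2,2,3,2,1,1⟩, ⟨1,2,2,3,2,1,0⟩, ⟨1,1,2,2,1,0,0⟩,
   ⟨1,1,1,1,1,1,1⟩, ⟨1,1,1,2,1,0,0⟩, ⟨0,1,1,1,1,1,1⟩, ⟨1,1,1,1,1,1,0⟩,
   ⟨1,0,1,1,1,1,1⟩, ⟨0,1,1,1,1,1,0⟩, ⟨1,0,1,1,1,1,0⟩, ⟨0,0,1,1,1,1,1⟩,
   ⟨1,1,1,1,1,0,0⟩, ⟨0,1,0,1,1,1,1⟩, ⟨0,1,1,2,1,0,0⟩, ⟨1,0,1,1,1,0,0⟩,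
   ⟨0,0,1,1,1,1,0⟩, ⟨1,1,1,1,0,0,0⟩, ⟨0,1,1,1,1,0,0⟩, ⟨0,1,0,1,1,1,0⟩,
   ⟨0,0,0,1,1,1,1⟩, ⟨1,0,1,1,0,0,0⟩, ⟨0,1,0,1,1,0,0⟩, ⟨0,0,1,1,1,0,0⟩,
   ⟨0,1,1,1,0,0,0⟩, ⟨0,0,0,1,1,1,0⟩, ⟨0,0,1,1,0,0,0⟩, ⟨1,0,1,0,0,0,0⟩,
   ⟨0,1,0,1,0,0,0⟩, ⟨0,0,0,1,1,0,0⟩, ⟨0,0,0,1,0,0,0⟩, ⟨0,0,0,0,0,0,1⟩,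
   ⟨1,0,0,0,0,0,0⟩, ⟨0,1,0,0,0,0,0⟩, ⟨0,0,1,0,0,0,0⟩]

/-- Whether `18 v₀ + w` with `w` in `q` lies outside of the polytope `|⟨r, w⟩| ≤ 18`. -/
def outside (q : NatVec) : Bool :=
  posRoots.any fun r =>
    !(Nat.ble (65 * r.height) (r.dot q + 18)) || !(Nat.ble (r.dot q) (65 * r.height + 18))

set_option maxHeartbeats 1000000 in
/-- The points `18 z(v₀)` for the elements `z` above `x` in the Bruhat order that satisfy the
permissibility condition at the base point `v₀` of the alcove. -/
def upperPoints : List NatVec :=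
  [⟨59,63,70,57,74,69,70⟩, ⟨59,65,70,56,74,69,70⟩, ⟨59,65,71,55,75,69,69⟩,
   ⟨61,65,65,61,75,65,69⟩, ⟨61,65,65,61,75,70,59⟩, ⟨61,65,65,61,76,63,70⟩,
   ⟨61,65,65,61,76,69,58⟩, ⟨61,65,65,61,81,58,65⟩, ⟨61,65,65,61,81,59,63⟩,
   ⟨62,63,65,62,74,65,70⟩, ⟨62,63,65,62,74,71,58⟩, ⟨62,63,65,62,75,63,71⟩,
   ⟨62,63,65,62,75,70,57⟩, ⟨62,63,65,62,81,57,65⟩, ⟨62,63,65,62,81,58,63⟩,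
   ⟨62,65,63,62,75,65,69⟩, ⟨62,65,63,62,75,70,59⟩, ⟨62,65,63,62,76,63,70⟩,
   ⟨62,65,63,62,76,69,58⟩, ⟨62,65,63,62,81,58,65⟩, ⟨62,65,63,62,81,59,63⟩,
   ⟨62,65,65,60,75,65,71⟩, ⟨62,65,65,60,75,72,57⟩, ⟨62,65,65,60,76,63,72⟩,
   ⟨62,65,65,60,76,71,56⟩, ⟨62,65,65,60,83,56,65⟩, ⟨62,65,65,60,83,57,63⟩,
   ⟨62,65,65,61,74,65,70⟩, ⟨62,65,65,61,74,71,58⟩, ⟨62,65,65,61,75,63,71⟩,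
   ⟨62,65,65,61,75,70,57⟩, ⟨62,65,65,61,81,57,65⟩, ⟨62,65,65,61,81,58,63⟩,
   ⟨62,65,65,71,54,75,70⟩, ⟨62,65,65,71,54,81,58⟩, ⟨62,65,65,72,53,74,71⟩,
   ⟨62,65,65,72,53,81,57⟩, ⟨62,65,65,78,47,74,65⟩, ⟨62,65,65,78,47,75,63⟩,
   ⟨63,63,63,63,74,65,70⟩, ⟨63,63,63,63,74,71,58⟩, ⟨63,63,63,63,75,63,71⟩,
   ⟨63,63,63,63,75,70,57⟩, ⟨63,63,63,63,81,57,65⟩, ⟨63,63,63,63,81,58,63⟩,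
   ⟨63,63,66,61,74,65,70⟩, ⟨63,63,66,61,74,71,58⟩, ⟨63,63,66,61,75,63,71⟩,
   ⟨63,63,66,61,75,70,57⟩, ⟨63,63,66,61,81,57,65⟩, ⟨63,63,66,61,81,58,63⟩,
   ⟨63,63,71,61,69,65,75⟩, ⟨63,65,63,61,75,65,71⟩, ⟨63,65,63,61,75,72,57⟩,
   ⟨63,65,63,61,76,63,72⟩, ⟨63,65,63,61,76,71,56⟩, ⟨63,65,63,61,83,56,65⟩,
   ⟨63,65,63,61,83,57,63⟩, ⟨63,65,63,62,74,65,70⟩, ⟨63,65,63,62,74,71,58⟩,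
   ⟨63,65,63,62,75,63,71⟩, ⟨63,65,63,62,75,70,57⟩, ⟨63,65,63,62,81,57,65⟩,
   ⟨63,65,63,62,81,58,63⟩, ⟨63,65,63,72,54,75,70⟩, ⟨63,65,63,72,54,81,58⟩,
   ⟨63,65,63,73,53,74,71⟩, ⟨63,65,63,73,53,81,57⟩, ⟨63,65,63,79,47,74,65⟩,
   ⟨63,65,63,79,47,75,63⟩, ⟨63,65,66,59,75,65,71⟩, ⟨63,65,66,59,75,72,57⟩,
   ⟨63,65,66,59,76,63,72⟩, ⟨63,65,66,59,76,71,56⟩, ⟨63,65,66,59,83,56,65⟩,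
   ⟨63,65,66,59,83,57,63⟩, ⟨63,65,66,60,74,65,70⟩, ⟨63,65,66,60,74,71,58⟩,
   ⟨63,65,66,60,75,63,71⟩, ⟨63,65,66,60,75,70,57⟩, ⟨63,65,66,60,81,57,65⟩,
   ⟨63,65,66,60,81,58,63⟩, ⟨63,65,66,70,54,75,70⟩, ⟨63,65,66,70,54,81,58⟩,
   ⟨63,65,66,71,53,74,71⟩, ⟨63,65,66,71,53,81,57⟩, ⟨63,65,66,77,47,74,65⟩,
   ⟨63,65,66,77,47,75,63⟩, ⟨63,65,67,59,75,65,69⟩, ⟨63,65,67,59,75,70,59⟩,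
   ⟨63,65,67,59,76,63,70⟩, ⟨63,65,67,59,76,69,58⟩, ⟨63,65,67,59,81,58,65⟩,
   ⟨63,65,67,59,81,59,63⟩, ⟨63,65,71,60,69,65,75⟩, ⟨65,63,58,63,74,69,70⟩,
   ⟨65,63,62,63,74,65,70⟩, ⟨65,63,62,63,74,71,58⟩, ⟨65,63,62,63,75,63,71⟩,
   ⟨65,63,62,63,75,70,57⟩, ⟨65,63,62,63,81,57,65⟩, ⟨65,63,62,63,81,58,63⟩,
   ⟨65,63,65,61,74,65,70⟩, ⟨65,63,65,61,74,71,58⟩, ⟨65,63,65,61,75,63,71⟩,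
   ⟨65,63,65,61,75,70,57⟩, ⟨65,63,65,61,81,57,65⟩, ⟨65,63,65,61,81,58,63⟩,
   ⟨65,63,69,63,67,65,77⟩, ⟨65,63,70,61,69,65,75⟩, ⟨65,65,58,62,74,69,70⟩,
   ⟨65,65,62,61,75,65,71⟩, ⟨65,65,62,61,75,72,57⟩, ⟨65,65,62,61,76,63,72⟩,
   ⟨65,65,62,61,76,71,56⟩, ⟨65,65,62,61,83,56,65⟩, ⟨65,65,62,61,83,57,63⟩,
   ⟨65,65,62,62,74,65,70⟩, ⟨65,65,62,62,74,71,58⟩, ⟨65,65,62,62,75,63,71⟩,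
   ⟨65,65,62,62,75,70,57⟩, ⟨65,65,62,62,81,57,65⟩, ⟨65,65,62,62,81,58,63⟩,
   ⟨65,65,62,72,54,75,70⟩, ⟨65,65,62,72,54,81,58⟩, ⟨65,65,62,73,53,74,71⟩,
   ⟨65,65,62,73,53,81,57⟩, ⟨65,65,62,79,47,74,65⟩, ⟨65,65,62,79,47,75,63⟩,
   ⟨65,65,65,59,75,65,71⟩, ⟨65,65,65,59,75,72,57⟩, ⟨65,65,65,59,76,63,72⟩,
   ⟨65,65,65,59,76,71,56⟩, ⟨65,65,65,59,83,56,65⟩, ⟨65,65,65,59,83,57,63⟩,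
   ⟨65,65,65,60,74,65,70⟩, ⟨65,65,65,60,74,71,58⟩, ⟨65,65,65,60,75,63,71⟩,
   ⟨65,65,65,60,75,70,57⟩, ⟨65,65,65,60,81,57,65⟩, ⟨65,65,65,60,81,58,63⟩,
   ⟨65,65,65,70,54,75,70⟩, ⟨65,65,65,70,54,81,58⟩, ⟨65,65,65,71,53,74,71⟩,
   ⟨65,65,65,71,53,81,57⟩, ⟨65,65,65,77,47,74,65⟩, ⟨65,65,65,77,47,75,63⟩,
   ⟨65,65,66,59,75,65,69⟩, ⟨65,65,66,59,75,70,59⟩, ⟨65,65,66,59,76,63,70⟩,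
   ⟨65,65,66,59,76,69,58⟩, ⟨65,65,66,59,81,58,65⟩, ⟨65,65,66,59,81,59,63⟩,
   ⟨65,65,69,62,67,65,77⟩, ⟨65,65,70,60,69,65,75⟩, ⟨66,63,63,62,74,65,70⟩,
   ⟨66,63,63,62,74,71,58⟩, ⟨66,63,63,62,75,63,71⟩, ⟨66,63,63,62,75,70,57⟩,
   ⟨66,63,63,62,81,57,65⟩, ⟨66,63,63,62,81,58,63⟩, ⟨66,63,69,62,68,65,76⟩,
   ⟨66,65,61,62,75,65,69⟩, ⟨66,65,61,62,75,70,59⟩, ⟨66,65,61,62,76,63,70⟩,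
   ⟨66,65,61,62,76,69,58⟩, ⟨66,65,61,62,81,58,65⟩, ⟨66,65,61,62,81,59,63⟩,
   ⟨66,65,63,60,75,65,71⟩, ⟨66,65,63,60,75,72,57⟩, ⟨66,65,63,60,76,63,72⟩,
   ⟨66,65,63,60,76,71,56⟩, ⟨66,65,63,60,83,56,65⟩, ⟨66,65,63,60,83,57,63⟩,
   ⟨66,65,63,61,74,65,70⟩, ⟨66,65,63,61,74,71,58⟩, ⟨66,65,63,61,75,63,71⟩,
   ⟨66,65,63,61,75,70,57⟩, ⟨66,65,63,61,81,57,65⟩, ⟨66,65,63,61,81,58,63⟩,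
   ⟨66,65,63,71,54,75,70⟩, ⟨66,65,63,71,54,81,58⟩, ⟨66,65,63,72,53,74,71⟩,
   ⟨66,65,63,72,53,81,57⟩, ⟨66,65,63,78,47,74,65⟩, ⟨66,65,63,78,47,75,63⟩,
   ⟨66,65,69,61,68,65,76⟩, ⟨67,65,62,61,75,65,69⟩, ⟨67,65,62,61,75,70,59⟩,
   ⟨67,65,62,61,76,63,70⟩, ⟨67,65,62,61,76,69,58⟩, ⟨67,65,62,61,81,58,65⟩,
   ⟨67,65,62,61,81,59,63⟩, ⟨69,63,65,57,74,69,70⟩, ⟨69,63,65,57,79,59,75⟩,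
   ⟨69,65,65,56,74,69,70⟩, ⟨69,65,65,56,79,59,75⟩, ⟨69,65,66,55,75,69,69⟩,
   ⟨70,63,63,58,74,69,70⟩, ⟨70,65,63,57,74,69,70⟩]

/-- Whether `q` is outside of the polytope or one of the `upperPoints`. -/
def stable (q : NatVec) : Bool := outside q || upperPoints.any (NatVec.beq q)

/-- The two clauses treat the walls ⟨r, ·⟩ = 0 and ⟨r, ·⟩ = 18, the only ones that `UpStep.bound`
leaves. With the shift by 64, ⟨r, p⟩ is `r.dot p - 64 * r.height`, so the tests read 0 < ⟨r, p⟩ ≤ 18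
- ht r and 18 - ht r ≤ ⟨r, p⟩ < 18. -/
theorem upperPoints_closed : (upperPoints.all fun p => posRoots.all fun r =>
    (!(Nat.ble (64 * r.height + 1) (r.dot p)) || !(Nat.ble (r.dot p) (63 * r.height + 18)) ||
      stable (p.subCoroot r (r.dot p - 64 * r.height))) &&
    (!(Nat.ble (r.dot p) (64 * r.height + 17)) || !(Nat.ble (63 * r.height + 18) (r.dot p)) ||
      stable (p.addCoroot r (64 * r.height + 18 - r.dot p)))) = true := by
  decide +kernel

/-- The coordinates of 18 (v₀ + l) are 1 mod 18; after the shift by 64 they are 65 ≡ 11. -/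
theorem upperPoints_not_translation : (upperPoints.all fun p =>
    !(p.a % 18 == 11 && p.b % 18 == 11 && p.c % 18 == 11 && p.d % 18 == 11 && p.e % 18 == 11 &&
      p.f % 18 == 11 && p.g % 18 == 11)) = true := by
  decide +kernel

/-- A simple reflection permutes the positive roots other than its own; hence every root is in the
list up to sign. -/
theorem posRoots_simpleReflect : ((List.finRange 7).all fun i => posRoots.all fun r =>
    r.beq (NatVec.simple i) ||
      (r.simpleReflectLE i && posRoots.any (r.simpleReflect i).beq)) = true := by
  decide +kernel

/-- Some simple reflection lowers the height of any listed vector that is not simple, so induction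
on the height shows that the list contains only roots. -/
theorem posRoots_descent : (posRoots.all fun r => (List.finRange 7).any fun i =>
    r.beq (NatVec.simple i) ||
      (r.simpleReflectLE i && Nat.blt (r.simpleReflect i).height r.height &&
        posRoots.any (r.simpleReflect i).beq)) = true := by
  decide +kernel

/-- In the last clause `r.a` is ⟨r, θ^∨⟩ (`form_theta`). The clause says that the affine reflection
s₀ moves v₀ across no wall other than that of θ. -/
theorem posRoots_bounds : (posRoots.all fun r => Nat.ble r.a 2 && Nat.ble r.b 2 &&
    Nat.ble r.c 3 && Nat.ble r.d 4 && Nat.ble r.e 3 && Nat.ble r.f 2 && Nat.ble r.g 1 &&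
    Nat.ble 1 r.height && (r.beq ⟨2, 2, 3, 4, 3, 2, 1⟩ || Nat.ble (r.height + r.a) 17)) = true := by
  decide +kernel

theorem simple_mem_posRoots : ((List.finRange 7).all fun i =>
    posRoots.any (NatVec.simple i).beq) = true := by
  decide +kernel

/-! ### Positive roots and heights. -/

theorem mulVec_eq (r : Fin 7 → ℤ) : CartanMatrix.E₇ *ᵥ r =
    ![2 * r 0 - r 2, 2 * r 1 - r 3, 2 * r 2 - r 0 - r 3, 2 * r 3 - r 1 - r 2 - r 4,
      2 * r 4 - r 3 - r 5, 2 * r 5 - r 4 - r 6, 2 * r 6 - r 5] := by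
  funext i
  fin_cases i <;> simp [CartanMatrix.E₇, Matrix.mulVec, dotProduct, Fin.sum_univ_succ] <;> ring

theorem dot_eq (r p : Fin 7 → ℤ) : r ⬝ᵥ p =
    r 0 * p 0 + r 1 * p 1 + r 2 * p 2 + r 3 * p 3 + r 4 * p 4 + r 5 * p 5 + r 6 * p 6 := by
  simp [dotProduct, Fin.sum_univ_succ]; ring

theorem form_single_right (x : Fin 7 → ℤ) (i : Fin 7) :
    form x (Pi.single i 1) = (CartanMatrix.E₇ *ᵥ x) i := by
  rw [form_comm, form, single_dotProduct, one_mul]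

theorem reflect_single (x : Fin 7 → ℤ) (i : Fin 7) :
    reflect (Pi.single i 1) x = Function.update x i (x i - (CartanMatrix.E₇ *ᵥ x) i) := by
  funext j
  rw [reflect, form_single_right]
  rcases eq_or_ne j i with rfl | h
  · simp
  · simp [h]

theorem toRoot_simple (i : Fin 7) : (NatVec.simple i).toRoot = Pi.single i 1 := by
  revert i; decide

theorem toRoot_simpleReflect (r : NatVec) (i : Fin 7) (h : r.simpleReflectLE i = true) :
    (r.simpleReflect i).toRoot = reflect (Pi.single i 1) r.toRoot := by
  rw [reflect_single, mulVec_eq]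
  fin_cases i <;> simp [NatVec.simpleReflectLE] at h <;>
    funext j <;> fin_cases j <;>
    simp [NatVec.simpleReflect, NatVec.toRoot, Function.update, h] <;> omega

/-- The positive roots. -/
def IsPosRoot (r : Fin 7 → ℤ) : Prop := ∃ a ∈ posRoots, a.toRoot = r

theorem isPosRoot_single (i : Fin 7) : IsPosRoot (Pi.single i 1) := by
  have h := simple_mem_posRoots
  simp only [List.all_eq_true, List.any_eq_true] at h
  obtain ⟨a, ha, hb⟩ := h i (List.mem_finRange i)
  exact ⟨a, ha, by rw [← NatVec.eq_of_beq hb, toRoot_simple]⟩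

theorem IsPosRoot.reflect_single {r : Fin 7 → ℤ} (hr : IsPosRoot r) (i : Fin 7)
    (h : r ≠ Pi.single i 1) : IsPosRoot (reflect (Pi.single i 1) r) := by
  obtain ⟨a, ha, rfl⟩ := hr
  have h1 := posRoots_simpleReflect
  simp only [List.all_eq_true, List.any_eq_true, Bool.or_eq_true, Bool.and_eq_true] at h1
  rcases h1 i (List.mem_finRange i) a ha with h2 | ⟨h2, b, hb, h3⟩
  · exact absurd (by rw [NatVec.eq_of_beq h2, toRoot_simple]) h
  · exact ⟨b, hb, by rw [← NatVec.eq_of_beq h3, toRoot_simpleReflect a i h2]⟩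

theorem form_neg_left (x y : Fin 7 → ℤ) : form (-x) y = -form x y := by
  simp [form]

theorem reflect_neg (r x : Fin 7 → ℤ) : reflect r (-x) = -reflect r x := by
  simp only [reflect, form_neg_left]; module

theorem IsRoot.isPosRoot_or_neg {r : Fin 7 → ℤ} (h : IsRoot r) :
    IsPosRoot r ∨ IsPosRoot (-r) := by
  induction h with
  | simple i => exact .inl (isPosRoot_single i)
  | reflect i r _ ih =>
    have key : E7.reflect (Pi.single i 1) (Pi.single i 1) = -Pi.single i 1 := by
      rw [E7.reflect, form_single]; module
    rcases ih with ih | ih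
    · by_cases hr : r = Pi.single i 1
      · exact .inr (by rw [hr, key, neg_neg]; exact isPosRoot_single i)
      · exact .inl (ih.reflect_single i hr)
    · by_cases hr : -r = Pi.single i 1
      · exact .inl (by rw [← neg_neg r, hr, reflect_neg, key, neg_neg]; exact isPosRoot_single i)
      · exact .inr (by rw [← reflect_neg]; exact ih.reflect_single i hr)

theorem isRoot_toRoot {a : NatVec} (ha : a ∈ posRoots) : IsRoot a.toRoot := by
  induction hn : a.height using Nat.strong_induction_on generalizing a with
  | _ n ih =>
    have h := posRoots_descent
    simp only [List.all_eq_true, List.any_eq_true, Bool.or_eq_true, Bool.and_eq_true,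
      Nat.blt_eq] at h
    obtain ⟨i, -, h1 | ⟨⟨h1, h2⟩, b, hb, h3⟩⟩ := h a ha
    · rw [NatVec.eq_of_beq h1, toRoot_simple]
      exact .simple i
    · rw [NatVec.eq_of_beq h3] at h2
      have h4 := (ih _ (hn ▸ h2) hb rfl).reflect i
      rwa [← NatVec.eq_of_beq h3, toRoot_simpleReflect a i h1,
        reflect_reflect _ _ (form_single i)] at h4

theorem IsRoot.neg {r : Fin 7 → ℤ} (h : IsRoot r) : IsRoot (-r) := by
  have h1 := h.reflect_mem r h
  rwa [show E7.reflect r r = -r by rw [E7.reflect, h.form_self]; module] at h1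

/-- The highest root. -/
def theta : Fin 7 → ℤ := ![2, 2, 3, 4, 3, 2, 1]

/-- The height of a root. -/
def height (r : Fin 7 → ℤ) : ℤ := r 0 + r 1 + r 2 + r 3 + r 4 + r 5 + r 6

theorem height_toRoot (a : NatVec) : height a.toRoot = a.height := by
  simp [height, NatVec.toRoot, NatVec.height]

theorem height_neg (r : Fin 7 → ℤ) : height (-r) = -height r := by
  simp [height]; ring

theorem IsPosRoot.bounds {r : Fin 7 → ℤ} (hr : IsPosRoot r) :
    (∀ j, 0 ≤ r j ∧ r j ≤ theta j) ∧ 0 < height r ∧ height r ≤ 17 ∧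
      (r = theta ∨ height r + r 0 ≤ 17) := by
  obtain ⟨a, ha, rfl⟩ := hr
  have h1 := posRoots_bounds
  simp only [List.all_eq_true, Bool.or_eq_true, Bool.and_eq_true, Nat.ble_eq] at h1
  obtain ⟨⟨⟨⟨⟨⟨⟨⟨b0, b1⟩, b2⟩, b3⟩, b4⟩, b5⟩, b6⟩, b7⟩, b8⟩ := h1 a ha
  refine ⟨fun j => ?_, ?_, ?_, ?_⟩
  · fin_cases j <;> simp [NatVec.toRoot, theta] <;> omega
  · rw [height_toRoot]; omega
  · rw [height_toRoot, NatVec.height]; omega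
  · rw [height_toRoot]
    rcases b8 with b8 | b8
    · left; rw [NatVec.eq_of_beq b8]; decide
    · right; simp only [NatVec.toRoot, Matrix.cons_val_zero]; omega

theorem IsRoot.height_ne_zero {r : Fin 7 → ℤ} (h : IsRoot r) :
    height r ≠ 0 ∧ |height r| ≤ 17 := by
  rcases h.isPosRoot_or_neg with h | h
  · have := h.bounds
    exact ⟨this.2.1.ne', abs_le.2 ⟨by linarith, by linarith⟩⟩
  · have := h.bounds
    rw [height_neg] at this
    exact ⟨by omega, abs_le.2 ⟨by linarith, by linarith⟩⟩

theorem form_theta (r : Fin 7 → ℤ) : form r theta = r 0 := by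
  rw [form, mulVec_eq, dot_eq]; simp [theta]

/-- The coroot of `r`. -/
def cor (r : Fin 7 → ℤ) : Fin 7 → ℤ := CartanMatrix.E₇ *ᵥ r

theorem cor_neg (r : Fin 7 → ℤ) : cor (-r) = -cor r := Matrix.mulVec_neg _ _

theorem dot_cor (r s : Fin 7 → ℤ) : r ⬝ᵥ cor s = form r s := rfl

/-! ### Upward steps and the closure of the certificate. -/

/-- `q` is obtained from `p` by an affine reflection whose hyperplane does not separate `p` from
the base point; all points are multiplied by `18`. -/
def UpStep (p q : Fin 7 → ℤ) : Prop :=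
  ∃ r k, IsRoot r ∧ 0 < (r ⬝ᵥ p - 18 * k) * (height r - 18 * k) ∧
    q = p - (r ⬝ᵥ p - 18 * k) • cor r

/-- The polytope given by `|⟨r, p - 18 v₀⟩| ≤ 18` for all roots `r`. -/
def InHull (p : Fin 7 → ℤ) : Prop := ∀ r, IsRoot r → |r ⬝ᵥ p - height r| ≤ 18

theorem dot_sub_smul_cor (g r p : Fin 7 → ℤ) (c : ℤ) :
    g ⬝ᵥ (p - c • cor r) = g ⬝ᵥ p - c * form g r := by
  rw [dotProduct_sub, dotProduct_smul, dot_cor, smul_eq_mul]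

theorem height_reflect (r g : Fin 7 → ℤ) :
    height (reflect r g) = height g - form g r * height r := by
  simp [height, reflect]; ring

/-- The polytope is convex and stable under the reflections s_r centred at 18 v₀. With u = ⟨r, p⟩ -
18k and v = ht r - 18k, the centred reflection of q is q + (u + v) r^∨, while p = q + u r^∨. Since u
and v have the same sign, p lies between q and this image. -/
theorem UpStep.inHull {p q : Fin 7 → ℤ} (h : UpStep p q) (hq : InHull q) : InHull p := by
  obtain ⟨r, k, hr, hpos, rfl⟩ := h
  intro g hg
  have h1 := hq g hg
  have h2 := hq (reflect r g) (hr.reflect_mem g hg)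
  rw [dot_sub_smul_cor] at h1 h2
  have h3 : form (reflect r g) r = - form g r := by
    rw [reflect, form_sub_left, form_smul_left, hr.form_self]; ring
  rw [h3, height_reflect, reflect, sub_dotProduct, smul_dotProduct, smul_eq_mul] at h2
  generalize form g r = n at *
  generalize r ⬝ᵥ p = d at *
  generalize g ⬝ᵥ p = e at *
  generalize height r = a at *
  generalize height g = b at *
  rw [abs_le] at *
  obtain ⟨h4, h5⟩ := h1
  obtain ⟨h6, h7⟩ := h2
  rcases pos_and_pos_or_neg_and_neg_of_mul_pos hpos with ⟨u, v⟩ | ⟨u, v⟩ <;>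
  rcases le_total 0 n with hn | hn <;> constructor <;> nlinarith

/-- As ⟨r, p⟩ + ⟨r, q⟩ = 36k, adding the polytope bounds for p and q gives |18k - ht r| ≤ 18. Since
0 < ht r < 18, only k = 0 and k = 1 remain. -/
theorem UpStep.bound {p q : Fin 7 → ℤ} (hq : InHull q) (hp : InHull p) {r : Fin 7 → ℤ} {k : ℤ}
    (hr : IsPosRoot r) (hr' : IsRoot r)
    (hpos : 0 < (r ⬝ᵥ p - 18 * k) * (height r - 18 * k))
    (h : q = p - (r ⬝ᵥ p - 18 * k) • cor r) :
    (k = 0 ∧ 0 < r ⬝ᵥ p ∧ r ⬝ᵥ p + height r ≤ 18) ∨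
      (k = 1 ∧ r ⬝ᵥ p < 18 ∧ 18 ≤ r ⬝ᵥ p + height r) := by
  have h1 := hp r hr'
  have h2 := hq r hr'
  rw [h, dot_sub_smul_cor, hr'.form_self] at h2
  obtain ⟨-, h3, h4, -⟩ := hr.bounds
  generalize r ⬝ᵥ p = d at *
  generalize height r = a at *
  rw [abs_le] at *
  have hk : k = 0 ∨ k = 1 := by omega
  rcases hk with rfl | rfl
  · left
    have : 0 < d := by nlinarith
    refine ⟨rfl, this, by omega⟩
  · right
    have : d < 18 := by nlinarith
    refine ⟨rfl, this, by omega⟩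

theorem dot_toPoint (a p : NatVec) : a.toRoot ⬝ᵥ p.toPoint = a.dot p - 64 * a.height := by
  rw [dot_eq]
  simp [NatVec.toRoot, NatVec.toPoint, NatVec.dot, NatVec.height]
  ring

theorem InHull.coord {q : Fin 7 → ℤ} (h : InHull q) (i : Fin 7) : |q i - 1| ≤ 18 := by
  have h1 := h _ (.simple i)
  have h2 : ∀ i, height (Pi.single i 1) = 1 := by decide
  rwa [h2 i, single_dotProduct, one_mul] at h1

/-- The bound on the coordinates of the result keeps the shifted values nonnegative, so the
truncated subtractions are exact. -/
theorem toPoint_subCoroot (p a : NatVec) (c : ℕ)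
    (h : ∀ i, |(p.toPoint - (c : ℤ) • cor a.toRoot) i - 1| ≤ 18) :
    (p.subCoroot a c).toPoint = p.toPoint - (c : ℤ) • cor a.toRoot := by
  simp only [abs_le] at h
  rw [cor, mulVec_eq] at *
  funext i
  have h1 := h i
  fin_cases i <;>
    simp [NatVec.toPoint, NatVec.toRoot, NatVec.subCoroot, mul_add, mul_sub] at h1 ⊢ <;>
    rw [Int.ofNat_sub (by zify; linarith)] <;> push_cast <;> ring

theorem toPoint_addCoroot (p a : NatVec) (c : ℕ)
    (h : ∀ i, |(p.toPoint + (c : ℤ) • cor a.toRoot) i - 1| ≤ 18) :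
    (p.addCoroot a c).toPoint = p.toPoint + (c : ℤ) • cor a.toRoot := by
  simp only [abs_le] at h
  rw [cor, mulVec_eq] at *
  funext i
  have h1 := h i
  fin_cases i <;>
    simp [NatVec.toPoint, NatVec.toRoot, NatVec.addCoroot, mul_add, mul_sub] at h1 ⊢ <;>
    rw [Int.ofNat_sub (by zify; linarith)] <;> push_cast <;> ring

theorem UpStep.symm_data {p q r : Fin 7 → ℤ} {k : ℤ}
    (hpos : 0 < (r ⬝ᵥ p - 18 * k) * (height r - 18 * k))
    (h : q = p - (r ⬝ᵥ p - 18 * k) • cor r) :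
    0 < ((-r) ⬝ᵥ p - 18 * (-k)) * (height (-r) - 18 * (-k)) ∧
      q = p - ((-r) ⬝ᵥ p - 18 * (-k)) • cor (-r) := by
  rw [height_neg, cor_neg, neg_dotProduct]
  refine ⟨by linarith, ?_⟩
  rw [h]; module

/-- Membership in the certificate. -/
def IsUpper (p : Fin 7 → ℤ) : Prop := ∃ a ∈ upperPoints, a.toPoint = p

theorem isUpper_of_stable {a : NatVec} (h : stable a = true) (ha : InHull a.toPoint) : IsUpper a.toPoint := by
  simp only [stable, outside, Bool.or_eq_true, List.any_eq_true] at h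
  rcases h with ⟨b, hb, h⟩ | ⟨b, hb, h⟩
  · exfalso
    have h1 := ha _ (isRoot_toRoot hb)
    rw [dot_toPoint, height_toRoot, abs_le] at h1
    simp only [Bool.not_eq_true', ← Bool.not_eq_true, Nat.ble_eq] at h
    omega
  · exact ⟨b, hb, by rw [NatVec.eq_of_beq h]⟩

theorem IsUpper.step {p q : Fin 7 → ℤ} (hp : IsUpper p) (h : UpStep p q) (hq : InHull q) : IsUpper q := by
  have hpK := h.inHull hq
  obtain ⟨r, k, hr, hpos, h⟩ := h
  -- The pairs (r, k) and (-r, -k) describe the same wall.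
  wlog hrp : IsPosRoot r generalizing r k
  · have h1 := UpStep.symm_data hpos h
    exact this _ _ hr.neg h1.1 h1.2 (hr.isPosRoot_or_neg.resolve_left hrp)
  have h2 := UpStep.bound hq hpK hrp hr hpos h
  obtain ⟨P, hP, rfl⟩ := hp
  obtain ⟨a, ha, rfl⟩ := hrp
  have h3 := upperPoints_closed
  simp only [List.all_eq_true, Bool.and_eq_true] at h3
  obtain ⟨h4, h5⟩ := h3 P hP a ha
  simp only [Bool.or_eq_true, Bool.not_eq_true', ← Bool.not_eq_true, Nat.ble_eq] at h4 h5
  rw [dot_toPoint, height_toRoot] at h2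
  rw [dot_toPoint] at h
  rcases h2 with ⟨rfl, h6, h7⟩ | ⟨rfl, h6, h7⟩
  · have h8 : ((a.dot P - 64 * a.height : ℕ) : ℤ) = a.dot P - 64 * a.height - 18 * 0 := by omega
    rw [← h8] at h
    have h10 := toPoint_subCoroot P a _ (h ▸ hq.coord)
    rw [h, ← h10] at hq ⊢
    exact isUpper_of_stable (by rcases h4 with (h4 | h4) | h4 <;> first | exact h4 | omega) hq
  · have h8 : ((64 * a.height + 18 - a.dot P : ℕ) : ℤ) = -(a.dot P - 64 * a.height - 18 * 1) := by
      omega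
    have h9 : q = P.toPoint + ((64 * a.height + 18 - a.dot P : ℕ) : ℤ) • cor a.toRoot := by
      rw [h8, h]; module
    have h10 := toPoint_addCoroot P a _ (h9 ▸ hq.coord)
    rw [h9, ← h10] at hq ⊢
    exact isUpper_of_stable (by rcases h5 with (h5 | h5) | h5 <;> first | exact h5 | omega) hq

theorem IsUpper.not_translation {p : Fin 7 → ℤ} (hp : IsUpper p) (l : Fin 7 → ℤ)
    (h : ∀ i, p i = 1 + 18 * l i) : False := by
  obtain ⟨a, ha, rfl⟩ := hp
  have h1 := upperPoints_not_translation
  simp only [List.all_eq_true] at h1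
  have h2 := h1 a ha
  have e0 := h 0
  have e1 := h 1
  have e2 := h 2
  have e3 := h 3
  have e4 := h 4
  have e5 := h 5
  have e6 := h 6
  simp [NatVec.toPoint] at e0 e1 e2 e3 e4 e5 e6
  simp at h2
  omega

theorem isUpper_base : IsUpper ![1, 1, 1, -4, 10, 1, 6] := by
  have h : upperPoints.any (NatVec.beq ⟨65, 65, 65, 60, 74, 65, 70⟩) = true := by decide +kernel
  simp only [List.any_eq_true] at h
  obtain ⟨a, ha, hb⟩ := h
  exact ⟨a, ha, by rw [← NatVec.eq_of_beq hb]; decide⟩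

/-! ### Affine reflections and their walls. -/

/-- The ambient space of the coweights. -/
abbrev Vec : Type := Fin 7 → ℝ

/-- The real point with given integral coordinates. -/
def castVec (p : Fin 7 → ℤ) : Vec := fun i => p i

theorem root'_apply (r : Root) (v : Vec) : rootSystem.root' r v = castVec r.1 ⬝ᵥ v := rfl

theorem coroot_apply (r : Root) : rootSystem.coroot r = castVec (cor r.1) := rfl

theorem castVec_dot (r p : Fin 7 → ℤ) : castVec r ⬝ᵥ castVec p = (r ⬝ᵥ p : ℤ) := by
  simp [castVec, dotProduct]

theorem castVec_sub_smul (p q : Fin 7 → ℤ) (c : ℤ) :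
    castVec (p - c • q) = castVec p - (c : ℝ) • castVec q := by
  funext i; simp [castVec]

theorem coreflection_apply' (r : Root) (v : Vec) :
    rootSystem.coreflection r v = v - (castVec r.1 ⬝ᵥ v) • castVec (cor r.1) := by
  rw [RootPairing.coreflection_apply]; rfl

/-- The affine reflection `v ↦ v - (⟨r, v⟩ - k) r^∨`. -/
noncomputable def affRefl (r : Root) (k : ℤ) : Vec ≃ᵃ[ℝ] Vec :=
  AffineWeyl.trans ((k : ℝ) • rootSystem.coroot r) * AffineWeyl.refl rootSystem r

/-- The affine function `⟨r, v⟩ - k`. -/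
def wall (r : Root) (k : ℤ) (v : Vec) : ℝ := castVec r.1 ⬝ᵥ v - k

theorem mul_apply' (g h : Vec ≃ᵃ[ℝ] Vec) (v : Vec) : (g * h) v = g (h v) := rfl

theorem trans_apply (ν v : Vec) : AffineWeyl.trans ν v = ν + v := rfl

theorem refl_apply (r : Root) (v : Vec) :
    AffineWeyl.refl rootSystem r v = v - (castVec r.1 ⬝ᵥ v) • castVec (cor r.1) :=
  coreflection_apply' r v

theorem affRefl_apply (r : Root) (k : ℤ) (v : Vec) :
    affRefl r k v = v - wall r k v • castVec (cor r.1) := by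
  rw [affRefl, mul_apply', trans_apply, refl_apply, coroot_apply, wall]
  module

theorem affRefl_linear (r : Root) (k : ℤ) (v : Vec) :
    (affRefl r k).linear v = v - (castVec r.1 ⬝ᵥ v) • castVec (cor r.1) :=
  coreflection_apply' r v

theorem root_dot_cor (r : Root) : castVec r.1 ⬝ᵥ castVec (cor r.1) = 2 := by
  rw [castVec_dot, dot_cor, r.2.form_self]; norm_num

theorem wall_affRefl (r : Root) (k : ℤ) (v : Vec) : wall r k (affRefl r k v) = -wall r k v := by
  rw [affRefl_apply, wall, dotProduct_sub, dotProduct_smul, root_dot_cor, wall, smul_eq_mul]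
  ring

theorem affRefl_mul_self (r : Root) (k : ℤ) : affRefl r k * affRefl r k = 1 := by
  ext1 v
  rw [mul_apply', affRefl_apply, wall_affRefl, affRefl_apply]
  simp

theorem affRefl_inv (r : Root) (k : ℤ) : (affRefl r k)⁻¹ = affRefl r k :=
  inv_eq_of_mul_eq_one_left (affRefl_mul_self r k)

/-- The opposite root. -/
def negRoot (r : Root) : Root := ⟨-r.1, r.2.neg⟩

theorem wall_neg (r : Root) (k : ℤ) (v : Vec) : wall (negRoot r) (-k) v = -wall r k v := by
  have : castVec (negRoot r).1 = -castVec r.1 := by funext i; simp [castVec, negRoot]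
  rw [wall, this, wall, neg_dotProduct]; push_cast; ring

theorem affRefl_neg (r : Root) (k : ℤ) : affRefl (negRoot r) (-k) = affRefl r k := by
  ext1 v
  have : castVec (cor (negRoot r).1) = -castVec (cor r.1) := by
    funext i; simp [castVec, negRoot, cor_neg]
  rw [affRefl_apply, affRefl_apply, wall_neg, this]; module

/-- `g` permutes the affine functions `⟨r, v⟩ - k`, compatibly with the coroots. -/
def PermutesWalls (g : Vec ≃ᵃ[ℝ] Vec) : Prop :=
  ∀ r k, ∃ r' k', (∀ v, wall r' k' (g v) = wall r k v) ∧
    g.linear (castVec (cor r.1)) = castVec (cor r'.1)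

theorem permutesWalls_one : PermutesWalls 1 := fun r k => ⟨r, k, fun _ => rfl, rfl⟩

theorem PermutesWalls.mul {g h : Vec ≃ᵃ[ℝ] Vec} (hg : PermutesWalls g) (hh : PermutesWalls h) :
    PermutesWalls (g * h) := by
  intro r k
  obtain ⟨r1, k1, h1, h1'⟩ := hh r k
  obtain ⟨r2, k2, h2, h2'⟩ := hg r1 k1
  refine ⟨r2, k2, fun v => ?_, ?_⟩
  · rw [mul_apply', h2, h1]
  · rw [← h2', ← h1']; rfl

theorem castVec_reflect_dot (r s : Fin 7 → ℤ) (v : Vec) :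
    castVec (reflect r s) ⬝ᵥ v = castVec s ⬝ᵥ v - form s r * (castVec r ⬝ᵥ v) := by
  rw [reflect, castVec_sub_smul, sub_dotProduct, smul_dotProduct, smul_eq_mul]

theorem cor_reflect (r s : Fin 7 → ℤ) : cor (reflect r s) = cor s - form s r • cor r := by
  rw [reflect, cor, Matrix.mulVec_sub, Matrix.mulVec_smul]; rfl

theorem permutesWalls_affRefl (r : Root) (k : ℤ) : PermutesWalls (affRefl r k) := by
  intro s m
  refine ⟨⟨reflect r.1 s.1, r.2.reflect_mem _ s.2⟩, m - k * form s.1 r.1, fun v => ?_, ?_⟩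
  · rw [affRefl_apply, wall, castVec_reflect_dot, dotProduct_sub, dotProduct_sub, dotProduct_smul,
      dotProduct_smul, root_dot_cor, castVec_dot, dot_cor, wall, wall]
    push_cast
    simp only [smul_eq_mul]
    ring
  · rw [affRefl_linear, castVec_dot, dot_cor, cor_reflect, castVec_sub_smul, form_comm]

/-- Elements that permute the walls conjugate reflections to reflections. -/
theorem conj_affRefl {g : Vec ≃ᵃ[ℝ] Vec} {r r' : Root} {k k' : ℤ}
    (h : ∀ v, wall r' k' (g v) = wall r k v)
    (h' : g.linear (castVec (cor r.1)) = castVec (cor r'.1)) :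
    g * affRefl r k = affRefl r' k' * g := by
  ext1 v
  rw [mul_apply', mul_apply', affRefl_apply, affRefl_apply, h, ← h',
    sub_eq_neg_add, ← vadd_eq_add, AffineEquiv.map_vadd, map_neg, map_smul, vadd_eq_add]
  module

/-- The simple affine reflections of `E₇`. -/
abbrev simpleRefls : Set (Vec ≃ᵃ[ℝ] Vec) := AffineWeyl.simpleAffine rootSystem simpleRoot highestRoot

theorem affRefl_zero (r : Root) : affRefl r 0 = AffineWeyl.refl rootSystem r := by
  ext1 v; rw [affRefl_apply, refl_apply, wall]; simp

theorem affRefl_one (r : Root) :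
    affRefl r 1 = AffineWeyl.trans (rootSystem.coroot r) * AffineWeyl.refl rootSystem r := by
  rw [affRefl, Int.cast_one, one_smul]

theorem mem_simpleRefls {g : Vec ≃ᵃ[ℝ] Vec} : g ∈ simpleRefls ↔
    (∃ i, g = affRefl (simpleRoot i) 0) ∨ g = affRefl highestRoot 1 := by
  simp only [affRefl_zero, affRefl_one, simpleRefls, AffineWeyl.simpleAffine, Set.mem_union,
    Set.mem_range, Set.mem_singleton_iff, eq_comm]

theorem exists_affRefl_of_mem {g : Vec ≃ᵃ[ℝ] Vec} (h : g ∈ simpleRefls) :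
    ∃ r k, g = affRefl r k := by
  rcases mem_simpleRefls.1 h with ⟨i, h⟩ | h
  exacts [⟨_, _, h⟩, ⟨_, _, h⟩]

theorem inv_of_mem {g : Vec ≃ᵃ[ℝ] Vec} (h : g ∈ simpleRefls) : g⁻¹ = g := by
  obtain ⟨r, k, rfl⟩ := exists_affRefl_of_mem h
  exact affRefl_inv r k

theorem exists_list_of_mem_closure {g : Vec ≃ᵃ[ℝ] Vec} (h : g ∈ Subgroup.closure simpleRefls) :
    ∃ l : List (Vec ≃ᵃ[ℝ] Vec), (∀ s ∈ l, s ∈ simpleRefls) ∧ l.prod = g := by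
  induction h using Subgroup.closure_induction'' with
  | one => exact ⟨[], by simp, rfl⟩
  | mem s hs => exact ⟨[s], by simpa using hs, by simp⟩
  | inv_mem s hs => exact ⟨[s], by simpa using hs, by simp [inv_of_mem hs]⟩
  | mul x y _ _ hx hy =>
    obtain ⟨l, hl, rfl⟩ := hx
    obtain ⟨m, hm, rfl⟩ := hy
    refine ⟨l ++ m, fun s hs => ?_, List.prod_append⟩
    rcases List.mem_append.1 hs with h | h
    exacts [hl s h, hm s h]

theorem permutesWalls_list (l : List (Vec ≃ᵃ[ℝ] Vec)) (hl : ∀ s ∈ l, s ∈ simpleRefls) :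
    PermutesWalls l.prod := by
  induction l with
  | nil => exact permutesWalls_one
  | cons s l ih =>
    rw [List.prod_cons]
    obtain ⟨r, k, h⟩ := exists_affRefl_of_mem (hl s (by simp))
    exact (h ▸ permutesWalls_affRefl r k).mul (ih fun t ht => hl t (by simp [ht]))

theorem permutesWalls_of_mem_closure {g : Vec ≃ᵃ[ℝ] Vec}
    (h : g ∈ Subgroup.closure simpleRefls) : PermutesWalls g := by
  obtain ⟨l, hl, rfl⟩ := exists_list_of_mem_closure h
  exact permutesWalls_list l hl

theorem exists_affRefl_of_isReflection {t : Vec ≃ᵃ[ℝ] Vec}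
    (ht : Coxeter.IsReflection simpleRefls t) : ∃ r k, t = affRefl r k := by
  obtain ⟨g, hg, s, hs, rfl⟩ := ht
  obtain ⟨r, k, rfl⟩ := exists_affRefl_of_mem hs
  obtain ⟨r', k', h1, h2⟩ := permutesWalls_of_mem_closure hg r k
  exact ⟨r', k', by rw [conj_affRefl h1 h2, mul_inv_cancel_right]⟩

/-! ### The base point and the exchange condition. -/

/-- The base point `18⁻¹ ∑ ρᵢ` of the base alcove. -/
noncomputable def basePoint : Vec := fun _ => 18⁻¹

theorem wall_basePoint (r : Root) (k : ℤ) :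
    18 * wall r k basePoint = ((height r.1 - 18 * k : ℤ) : ℝ) := by
  simp [wall, basePoint, dotProduct, castVec, Fin.sum_univ_succ, height]
  ring

/-- Heights of roots are nonzero and at most 17 in absolute value, hence never divisible by 18. -/
theorem wall_basePoint_ne_zero (r : Root) (k : ℤ) : wall r k basePoint ≠ 0 := by
  intro h
  have h1 := wall_basePoint r k
  rw [h, mul_zero, eq_comm, Int.cast_eq_zero] at h1
  have h2 := r.2.height_ne_zero
  rw [abs_le] at h2
  omega

theorem wall_affRefl_basePoint (r s : Root) (k m : ℤ) :
    18 * wall r k (affRefl s m basePoint) =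
      ((height r.1 - 18 * k - (height s.1 - 18 * m) * form r.1 s.1 : ℤ) : ℝ) := by
  have h1 : wall r k (affRefl s m basePoint) =
      wall r k basePoint - wall s m basePoint * form r.1 s.1 := by
    rw [affRefl_apply, wall, dotProduct_sub, dotProduct_smul, castVec_dot, dot_cor, wall,
      wall, smul_eq_mul]
    ring
  rw [h1, mul_sub, ← mul_assoc, wall_basePoint, wall_basePoint]
  push_cast; ring

theorem height_single (i : Fin 7) : height (Pi.single i 1) = 1 := by
  revert i; decide

theorem height_theta : height theta = 17 := by decide

/-- The only wall separating the base alcove from its image under a simple reflection is the wall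
of this reflection. -/
theorem eq_affRefl_of_separates {s : Vec ≃ᵃ[ℝ] Vec} (hs : s ∈ simpleRefls) (r : Root) (k : ℤ)
    (h : wall r k basePoint * wall r k (s basePoint) < 0) : affRefl r k = s := by
  wlog hr : IsPosRoot r.1 generalizing r k
  · rw [← affRefl_neg]
    refine this _ _ ?_ (r.2.isPosRoot_or_neg.resolve_left hr)
    rwa [wall_neg, wall_neg, neg_mul_neg]
  have h1 := hr.bounds
  have key : ∀ (s : Root) (m : ℤ), wall r k basePoint * wall r k (affRefl s m basePoint) < 0 →
      (height r.1 - 18 * k) *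
        (height r.1 - 18 * k - (height s.1 - 18 * m) * form r.1 s.1) < 0 := by
    intro s m h
    rw [← Int.cast_lt (R := ℝ), Int.cast_mul, ← wall_basePoint, ← wall_affRefl_basePoint]
    push_cast
    linarith
  rcases mem_simpleRefls.1 hs with ⟨i, rfl⟩ | rfl
  · have h2 := key _ _ h
    simp only [simpleRoot, height_single] at h2
    by_cases hri : r.1 = Pi.single i 1
    · rw [hri, form_single, height_single] at h2
      have hk : k = 0 := by
        rcases mul_neg_iff.1 h2 with h2 | h2 <;> omega
      rw [hk, show r = simpleRoot i from Subtype.ext hri]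
    · exfalso
      -- Both r and s_i(r) are positive roots with heights strictly between 0 and 18, so no multiple
      -- of 18 lies between the two values.
      have h3 := (hr.reflect_single i hri).bounds
      rw [height_reflect, height_single] at h3
      rcases mul_neg_iff.1 h2 with h2 | h2 <;> omega
  · have h2 := key _ _ h
    rw [show highestRoot.1 = theta from rfl, height_theta, form_theta] at h2
    have h0 := (h1.1 0).1
    obtain ⟨-, h3, h4, h5 | h5⟩ := h1
    · rw [h5, height_theta] at h2
      have hk : k = 1 := by
        rcases mul_neg_iff.1 h2 with h2 | h2 <;> simp [theta] at h2 <;> omega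
      rw [hk, show r = highestRoot from Subtype.ext h5]
    · exfalso
      -- The values are ht r and ht r + r₀, both between 1 and 17.
      rcases mul_neg_iff.1 h2 with h2 | h2 <;> omega

theorem PermutesWalls.wall_ne_zero {g : Vec ≃ᵃ[ℝ] Vec} (hg : PermutesWalls g⁻¹) (r : Root)
    (k : ℤ) : wall r k (g basePoint) ≠ 0 := by
  obtain ⟨r', k', h, -⟩ := hg r k
  rw [← h, show g⁻¹ (g basePoint) = basePoint from g.symm_apply_apply _]
  exact wall_basePoint_ne_zero r' k'

/-- The exchange condition: if a wall separates the base point from its image under the product of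
a word, then the corresponding reflection deletes a letter. -/
theorem exists_word_of_separates (l : List (Vec ≃ᵃ[ℝ] Vec)) (hl : ∀ s ∈ l, s ∈ simpleRefls)
    (r : Root) (k : ℤ) (h : wall r k basePoint * wall r k (l.prod basePoint) < 0) :
    ∃ l' : List (Vec ≃ᵃ[ℝ] Vec), (∀ s ∈ l', s ∈ simpleRefls) ∧ l'.length + 1 = l.length ∧
      l'.prod = affRefl r k * l.prod := by
  induction l generalizing r k with
  | nil => exact absurd h (not_lt.2 (mul_self_nonneg _))
  | cons s l ih =>
    have hs : s ∈ simpleRefls := hl s (by simp)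
    have hl' : ∀ t ∈ l, t ∈ simpleRefls := fun t ht => hl t (by simp [ht])
    have hss : s * s = 1 := by rw [mul_eq_one_iff_inv_eq, inv_of_mem hs]
    rw [List.prod_cons] at h
    by_cases hsep : wall r k basePoint * wall r k (s basePoint) < 0
    · refine ⟨l, hl', rfl, ?_⟩
      rw [List.prod_cons, eq_affRefl_of_separates hs r k hsep, ← mul_assoc, hss, one_mul]
    -- The wall is carried along by s. The new wall separates the base point from its image under
    -- the tail, so the deletion takes place there.
    · obtain ⟨r', k', h1, h2⟩ := permutesWalls_of_mem_closure (Subgroup.subset_closure hs) r k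
      have h3 : ∀ v, wall r k (s v) = wall r' k' v := fun v => by
        rw [← h1 (s v), ← mul_apply', hss]; rfl
      rw [h3] at hsep
      rw [mul_apply', h3] at h
      have h4 : wall r' k' basePoint * wall r' k' (l.prod basePoint) < 0 := by
        have h5 := wall_basePoint_ne_zero r k
        have h6 := wall_basePoint_ne_zero r' k'
        have h7 := lt_of_le_of_ne (not_lt.1 hsep) (mul_ne_zero h5 h6).symm
        rcases mul_pos_iff.1 h7 with ⟨a, b⟩ | ⟨a, b⟩
        · exact mul_neg_of_pos_of_neg b (neg_of_mul_neg_right h a.le)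
        · exact mul_neg_of_neg_of_pos b (pos_of_mul_neg_right h a.le)
      obtain ⟨l', h8, h9, h10⟩ := ih hl' r' k' h4
      refine ⟨s :: l', ?_, by simp [h9], ?_⟩
      · intro t ht
        rcases List.mem_cons.1 ht with rfl | ht
        exacts [hs, h8 t ht]
      · rw [List.prod_cons, List.prod_cons, h10, ← mul_assoc, ← mul_assoc]
        congr 1
        have h11 := conj_affRefl h1 h2
        calc s * affRefl r' k' = s * (affRefl r' k' * s) * s := by
              rw [mul_assoc, mul_assoc, hss, mul_one]
          _ = affRefl r k * s := by rw [← h11, ← mul_assoc, hss, one_mul]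

/-- An element that is not a product of simple reflections has length `sInf ∅ = 0`. -/
theorem mem_closure_of_length_pos {g : Vec ≃ᵃ[ℝ] Vec} (h : 0 < Coxeter.length simpleRefls g) :
    g ∈ Subgroup.closure simpleRefls := by
  obtain ⟨n, l, hl, rfl, -⟩ := Nat.nonempty_of_pos_sInf h
  exact Subgroup.list_prod_mem _ fun s hs => Subgroup.subset_closure (hl s hs)

theorem mem_closure_of_isReflection {G : Type*} [Group G] {S : Set G} {t : G}
    (ht : Coxeter.IsReflection S t) : t ∈ Subgroup.closure S := by
  obtain ⟨g, hg, s, hs, rfl⟩ := ht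
  exact mul_mem (mul_mem hg (Subgroup.subset_closure hs)) (inv_mem hg)

/-- If a reflection increases the length of `a`, its wall does not separate the base point from
its image under `a`. -/
theorem wall_mul_wall_pos {a : Vec ≃ᵃ[ℝ] Vec} (ha : a ∈ Subgroup.closure simpleRefls) {r : Root}
    {k : ℤ} (h : Coxeter.length simpleRefls a < Coxeter.length simpleRefls (affRefl r k * a)) :
    0 < wall r k basePoint * wall r k (a basePoint) := by
  have h1 := wall_basePoint_ne_zero r k
  have h2 := (permutesWalls_of_mem_closure (inv_mem ha)).wall_ne_zero r k
  by_contra h3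
  have h4 := lt_of_le_of_ne (not_lt.1 h3) (mul_ne_zero h1 h2)
  obtain ⟨l0, hl0, hl0'⟩ := exists_list_of_mem_closure ha
  obtain ⟨l, hl, rfl, hlen⟩ := Nat.sInf_mem (s := {n : ℕ | ∃ l : List (Vec ≃ᵃ[ℝ] Vec),
    (∀ s ∈ l, s ∈ simpleRefls) ∧ l.prod = a ∧ l.length = n}) ⟨_, l0, hl0, hl0', rfl⟩
  obtain ⟨l', h5, h6, h7⟩ := exists_word_of_separates l hl r k h4
  have h8 : Coxeter.length simpleRefls (affRefl r k * l.prod) ≤ l'.length :=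
    Nat.sInf_le ⟨l', h5, h7, rfl⟩
  have h9 : l.length = Coxeter.length simpleRefls l.prod := hlen
  omega

/-! ### From the Bruhat order to chains of integral points. -/

/-- The base alcove of `E₇`. -/
abbrev baseAlcove : Set Vec := AffineWeyl.alcove rootSystem simpleRoot highestRoot

theorem castVec_single_dot (i : Fin 7) (v : Vec) : castVec (Pi.single i 1) ⬝ᵥ v = v i := by
  have : castVec (Pi.single i 1) = Pi.single i 1 := by
    funext j; rcases eq_or_ne j i with rfl | h <;> simp [castVec, *]
  rw [this, single_dotProduct, one_mul]

theorem mem_baseAlcove {v : Vec} :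
    v ∈ baseAlcove ↔ (∀ i, 0 < v i) ∧ castVec theta ⬝ᵥ v < 1 := by
  have : ∀ i, rootSystem.root' (simpleRoot i) v = v i := fun i => castVec_single_dot i v
  simp only [baseAlcove, AffineWeyl.alcove, Set.mem_ofPred_eq, this]
  rfl

theorem basePoint_mem : basePoint ∈ baseAlcove := by
  rw [mem_baseAlcove]
  refine ⟨fun i => by norm_num [basePoint], ?_⟩
  simp [castVec, theta, dotProduct, basePoint, Fin.sum_univ_succ]
  norm_num

theorem IsPosRoot.dot_mem_Ioo {r : Fin 7 → ℤ} (hr : IsPosRoot r) {v : Vec}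
    (hv : v ∈ baseAlcove) : castVec r ⬝ᵥ v ∈ Set.Ioo (0 : ℝ) 1 := by
  rw [mem_baseAlcove] at hv
  have hb := hr.bounds
  constructor
  · refine Finset.sum_pos' (fun j _ => mul_nonneg (Int.cast_nonneg (hb.1 j).1) (hv.1 j).le) ?_
    by_contra! h
    have h0 : ∀ j, r j = 0 := fun j => by
      by_contra h1
      have h2 : (0 : ℝ) < r j := Int.cast_pos.2 (lt_of_le_of_ne (hb.1 j).1 (Ne.symm h1))
      exact absurd (h j (Finset.mem_univ j)) (not_le.2 (mul_pos h2 (hv.1 j)))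
    have := hb.2.1
    simp [height, h0] at this
  · refine lt_of_le_of_lt (Finset.sum_le_sum fun j _ => ?_) hv.2
    exact mul_le_mul_of_nonneg_right (Int.cast_le.2 (hb.1 j).2) (hv.1 j).le

/-- Positive roots take values strictly between 0 and 1 on the alcove, so no wall meets it. -/
theorem wall_mul_wall_pos_of_mem {u v : Vec} (hu : u ∈ baseAlcove) (hv : v ∈ baseAlcove)
    (r : Root) (k : ℤ) : 0 < wall r k u * wall r k v := by
  wlog hr : IsPosRoot r.1 generalizing r k
  · have := this (negRoot r) (-k) (r.2.isPosRoot_or_neg.resolve_left hr)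
    rwa [wall_neg, wall_neg, neg_mul_neg] at this
  have h1 := hr.dot_mem_Ioo hu
  have h2 := hr.dot_mem_Ioo hv
  rw [wall, wall]
  rcases le_or_gt k 0 with hk | hk
  · have : (k : ℝ) ≤ 0 := Int.cast_nonpos.2 hk
    exact mul_pos (by linarith [h1.1]) (by linarith [h2.1])
  · have : (1 : ℝ) ≤ k := by exact_mod_cast hk
    exact mul_pos_of_neg_of_neg (by linarith [h1.2]) (by linarith [h2.2])

/-- A step in the Bruhat order, seen on the images of the base point under `a ω` and `t a ω`. -/
theorem upStep_of_length_lt {a t ω : Vec ≃ᵃ[ℝ] Vec} (ht : Coxeter.IsReflection simpleRefls t)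
    (h : Coxeter.length simpleRefls a < Coxeter.length simpleRefls (t * a))
    (hω : ω basePoint ∈ baseAlcove) {p : Fin 7 → ℤ}
    (hp : (18 : ℝ) • (a * ω) basePoint = castVec p) :
    ∃ q, UpStep p q ∧ (18 : ℝ) • (t * a * ω) basePoint = castVec q := by
  -- The strict inequality gives t a positive length, so t a, and with it a, is a product of simple
  -- reflections.
  have ha : a ∈ Subgroup.closure simpleRefls := by
    have := mul_mem (inv_mem (mem_closure_of_isReflection ht))
      (mem_closure_of_length_pos (lt_of_le_of_lt (Nat.zero_le _) h))
    rwa [inv_mul_cancel_left] at this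
  obtain ⟨r, k, rfl⟩ := exists_affRefl_of_isReflection ht
  have h1 := wall_mul_wall_pos ha h
  -- The points v₀ and ω(v₀) are in one alcove, so no wall separates their images under a. This
  -- transfers the sign condition from a to a ω.
  have h2 : 0 < wall r k (a basePoint) * wall r k (a (ω basePoint)) := by
    obtain ⟨r', k', h3, -⟩ := permutesWalls_of_mem_closure (inv_mem ha) r k
    have h4 : ∀ v, wall r k (a v) = wall r' k' v := fun v => by
      rw [← h3, show a⁻¹ (a v) = v from a.symm_apply_apply _]
    rw [h4, h4]
    exact wall_mul_wall_pos_of_mem basePoint_mem hω r' k'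
  have h5 : 18 * wall r k ((a * ω) basePoint) = ((r.1 ⬝ᵥ p - 18 * k : ℤ) : ℝ) := by
    rw [wall, mul_sub, ← smul_eq_mul, ← dotProduct_smul, hp, castVec_dot]; push_cast; ring
  refine ⟨p - (r.1 ⬝ᵥ p - 18 * k) • cor r.1, ⟨r.1, k, r.2, ?_, rfl⟩, ?_⟩
  · rw [← Int.cast_lt (R := ℝ), Int.cast_mul, ← h5, ← wall_basePoint, mul_apply', Int.cast_zero]
    have h6 : 0 < wall r k (a (ω basePoint)) * wall r k basePoint := by
      rcases mul_pos_iff.1 h1 with ⟨u, v⟩ | ⟨u, v⟩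
      · exact mul_pos ((pos_iff_pos_of_mul_pos h2).1 v) u
      · exact mul_pos_of_neg_of_neg ((neg_iff_neg_of_mul_pos h2).1 v) u
    linarith
  · rw [castVec_sub_smul, ← hp, ← h5, mul_assoc, mul_apply', affRefl_apply]
    module

theorem castVec_injective : Function.Injective castVec := fun _ _ h =>
  funext fun i => Int.cast_injective (congrFun h i)

theorem chain_of_bruhatLE {a b ω : Vec ≃ᵃ[ℝ] Vec} (h : Coxeter.BruhatLE simpleRefls a b)
    (hω : ω basePoint ∈ baseAlcove) {p q : Fin 7 → ℤ}
    (hp : (18 : ℝ) • (a * ω) basePoint = castVec p)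
    (hq : (18 : ℝ) • (b * ω) basePoint = castVec q) : Relation.ReflTransGen UpStep p q := by
  induction h using Relation.ReflTransGen.head_induction_on generalizing p with
  | refl => rw [castVec_injective (hp.symm.trans hq)]
  | head h _ ih =>
    obtain ⟨t, ht, rfl, hlt⟩ := h
    obtain ⟨p', h1, h2⟩ := upStep_of_length_lt ht hlt hω hp
    exact .head h1 (ih h2)

theorem inHull_of_chain {p q : Fin 7 → ℤ} (h : Relation.ReflTransGen UpStep p q)
    (hq : InHull q) : InHull p := by
  induction h using Relation.ReflTransGen.head_induction_on with
  | refl => exact hq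
  | head h _ ih => exact h.inHull ih

theorem IsUpper.of_chain {p q : Fin 7 → ℤ} (hp : IsUpper p)
    (h : Relation.ReflTransGen UpStep p q) (hq : InHull q) : IsUpper q := by
  induction h using Relation.ReflTransGen.head_induction_on with
  | refl => exact hp
  | head h h' ih => exact ih (hp.step h (inHull_of_chain h' hq))

/-! ### Minuscule coweights -/

/-- Integral vectors that pair with the roots to `-1`, `0` or `1`. -/
def IsMinusculeInt (m : Fin 7 → ℤ) : Prop := ∀ r, IsRoot r → |r ⬝ᵥ m| ≤ 1

theorem isMinusculeInt_of_posRoots {m : Fin 7 → ℤ}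
    (h : ∀ r, IsPosRoot r → |r ⬝ᵥ m| ≤ 1) : IsMinusculeInt m := by
  intro r hr
  rcases hr.isPosRoot_or_neg with h1 | h1
  · exact h r h1
  · simpa [neg_dotProduct] using h _ h1

theorem IsMinusculeInt.reflect {m : Fin 7 → ℤ} (hm : IsMinusculeInt m) {s : Fin 7 → ℤ}
    (hs : IsRoot s) : IsMinusculeInt (m - (s ⬝ᵥ m) • cor s) := by
  intro r hr
  have h := hm _ (hs.reflect_mem r hr)
  rwa [E7.reflect, sub_dotProduct, smul_dotProduct, smul_eq_mul, mul_comm,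
    ← dot_sub_smul_cor] at h

theorem isMinuscule_castVec {m : Fin 7 → ℤ} :
    AffineWeyl.IsMinuscule rootSystem (castVec m) ↔ IsMinusculeInt m := by
  have key : ∀ n : ℤ, (((n : ℝ) = -1 ∨ (n : ℝ) = 0 ∨ (n : ℝ) = 1) ↔ |n| ≤ 1) := fun n => by
    have : ((n : ℝ) = -1 ∨ (n : ℝ) = 0 ∨ (n : ℝ) = 1) ↔ (n = -1 ∨ n = 0 ∨ n = 1) := by
      norm_cast
    rw [this, abs_le]; omega
  constructor
  · intro h r hr
    have h1 := h ⟨r, hr⟩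
    rwa [root'_apply, castVec_dot, key] at h1
  · intro h r
    rw [root'_apply, castVec_dot, key]
    exact h r.1 r.2

theorem castVec_mem_coweightLattice (m : Fin 7 → ℤ) :
    castVec m ∈ AffineWeyl.coweightLattice rootSystem := fun r => ⟨r.1 ⬝ᵥ m, by
  rw [root'_apply, castVec_dot]⟩

theorem root'_simpleRoot (i : Fin 7) (v : Vec) : rootSystem.root' (simpleRoot i) v = v i :=
  castVec_single_dot i v

theorem exists_castVec {μ : Vec} (h : μ ∈ AffineWeyl.coweightLattice rootSystem) :
    ∃ m, castVec m = μ := by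
  choose m hm using fun i => h (simpleRoot i)
  exact ⟨m, funext fun i => by rw [← root'_simpleRoot i μ, hm]; rfl⟩

theorem castVec_rho7 : castVec (Pi.single 6 1) = rho7 := by
  funext j; rcases eq_or_ne j 6 with rfl | h <;> simp [castVec, rho7, *]

theorem isMinusculeInt_rho7 : IsMinusculeInt (Pi.single 6 1) := by
  refine isMinusculeInt_of_posRoots fun r hr => ?_
  rw [dotProduct_single_one, abs_le]
  have := hr.bounds.1 6
  simp [theta] at this
  omega

theorem isRoot_theta : IsRoot theta := isRoot_highest

/-- Pairing with the highest root gives at most 1, and all its coefficients except the last are at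
least 2. -/
theorem eq_rho7_of_dominant {m : Fin 7 → ℤ} (hm : IsMinusculeInt m) (h0 : ∀ i, 0 ≤ m i)
    (hne : m ≠ 0) : m = Pi.single 6 1 := by
  have h := hm _ isRoot_theta
  rw [dot_eq, abs_le] at h
  simp [theta] at h
  have a0 := h0 0
  have a1 := h0 1
  have a2 := h0 2
  have a3 := h0 3
  have a4 := h0 4
  have a5 := h0 5
  have a6 := h0 6
  have h6 : m 6 ≠ 0 := fun h6 => hne <| funext fun i => by
    fin_cases i <;> simp <;> omega
  funext i
  fin_cases i <;> simp <;> omega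

theorem unique_minuscule (μ : Vec) :
    (μ ∈ AffineWeyl.coweightLattice rootSystem ∧ AffineWeyl.IsMinuscule rootSystem μ ∧
      AffineWeyl.IsDominant rootSystem simpleRoot μ ∧ μ ≠ 0) ↔ μ = rho7 := by
  constructor
  · rintro ⟨h1, h2, h3, h4⟩
    obtain ⟨m, rfl⟩ := exists_castVec h1
    rw [isMinuscule_castVec] at h2
    rw [← castVec_rho7, eq_rho7_of_dominant h2 (fun i => ?_) (fun h => ?_)]
    · have := h3 i
      rw [root'_simpleRoot] at this
      exact Int.cast_nonneg_iff.1 this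
    · exact h4 (funext fun i => by simp [castVec, h])
  · rintro rfl
    rw [← castVec_rho7]
    refine ⟨castVec_mem_coweightLattice _, isMinuscule_castVec.2 isMinusculeInt_rho7,
      fun i => ?_, fun h => ?_⟩
    · rw [root'_simpleRoot, castVec]
      exact Int.cast_nonneg (by revert i; decide)
    · simpa [castVec] using congrFun h 6

/-- The Weyl group of `E₇`. -/
noncomputable abbrev weyl : Subgroup (Vec ≃ₗ[ℝ] Vec) := AffineWeyl.finiteWeyl rootSystem

theorem coreflection_mem (r : Root) : rootSystem.coreflection r ∈ weyl :=
  Subgroup.subset_closure ⟨r, rfl⟩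

theorem coreflection_castVec (r : Root) (m : Fin 7 → ℤ) :
    rootSystem.coreflection r (castVec m) = castVec (m - (r.1 ⬝ᵥ m) • cor r.1) := by
  rw [coreflection_apply', castVec_dot, castVec_sub_smul]

/-- Every nonzero minuscule coweight is conjugate to `ρ₇`. -/
theorem exists_weyl_eq_rho7 {m : Fin 7 → ℤ} (hm : IsMinusculeInt m) (h0 : m ≠ 0) :
    ∃ w ∈ weyl, w (castVec m) = rho7 := by
  -- The vector is the sum of the positive roots, which pairs to 2 with each simple coroot.
  -- Reflecting at a coordinate -1 thus raises `f` by 2, while `f` is at most the coefficient sum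
  -- 399 on minuscule coweights.
  let f : (Fin 7 → ℤ) → ℤ := fun m => ![34, 49, 66, 96, 75, 52, 27] ⬝ᵥ m
  have hcoord : ∀ {m}, IsMinusculeInt m → ∀ i, |m i| ≤ 1 := fun hm i => by
    simpa using hm _ (.simple i)
  have hf : ∀ {m}, IsMinusculeInt m → f m ≤ 399 := fun {m} hm => by
    have h := fun i => abs_le.1 (hcoord hm i)
    have a0 := h 0
    have a1 := h 1
    have a2 := h 2
    have a3 := h 3
    have a4 := h 4
    have a5 := h 5
    have a6 := h 6
    simp only [f]
    rw [dot_eq]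
    simp
    omega
  induction hn : (400 - f m).toNat using Nat.strong_induction_on generalizing m with
  | _ n ih =>
    by_cases hdom : ∀ i, 0 ≤ m i
    · exact ⟨1, one_mem _, by rw [eq_rho7_of_dominant hm hdom h0, castVec_rho7]; rfl⟩
    · push Not at hdom
      obtain ⟨i, hi⟩ := hdom
      have hi1 : m i = -1 := by have := abs_le.1 (hcoord hm i); omega
      have hm' := hm.reflect (.simple i)
      rw [single_dotProduct, one_mul, hi1] at hm'
      have hf' : f (m - (-1 : ℤ) • cor (Pi.single i 1)) = f m + 2 := by
        have h2 : form ![34, 49, 66, 96, 75, 52, 27] (Pi.single i 1) = 2 := by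
          rw [form_single_right, mulVec_eq]
          exact (by decide : ∀ i, _ = _) i
        simp only [f]
        rw [dot_sub_smul_cor, h2]; ring
      have h0' : m - (-1 : ℤ) • cor (Pi.single i 1) ≠ 0 := fun h => by
        have h2 := congrFun h i
        have h3 : cor (Pi.single i 1) i = 2 := by
          rw [← form_single i, form, single_dotProduct, one_mul]; rfl
        simp [h3, hi1] at h2
      obtain ⟨w, hw, hw'⟩ := ih _ (by have := hf hm'; have := hf hm; omega) hm' h0' rfl
      refine ⟨w * rootSystem.coreflection (simpleRoot i), mul_mem hw (coreflection_mem _), ?_⟩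
      rw [LinearEquiv.mul_apply, coreflection_castVec, simpleRoot, single_dotProduct, one_mul, hi1,
        hw']

theorem castVec_mem_orbit {m : Fin 7 → ℤ} (hm : IsMinusculeInt m) (h0 : m ≠ 0) :
    castVec m ∈ AffineWeyl.orbit rootSystem rho7 := by
  obtain ⟨w, hw, h⟩ := exists_weyl_eq_rho7 hm h0
  exact ⟨w⁻¹, inv_mem hw, by rw [← h, ← LinearEquiv.mul_apply, inv_mul_cancel]; rfl⟩

theorem coroot_mem (r : Root) : castVec (cor r.1) ∈ AffineWeyl.corootLattice rootSystem :=
  AddSubgroup.subset_closure ⟨r, rfl⟩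

/-- The Weyl group preserves minuscule coweights and their classes modulo coroots. -/
theorem weyl_castVec {w : Vec ≃ₗ[ℝ] Vec} (hw : w ∈ weyl) {m : Fin 7 → ℤ} (hm : IsMinusculeInt m) :
    ∃ m', IsMinusculeInt m' ∧ w (castVec m) = castVec m' ∧
      castVec m' - castVec m ∈ AffineWeyl.corootLattice rootSystem := by
  have refl : ∀ (r : Root) {m : Fin 7 → ℤ}, IsMinusculeInt m → ∃ m', IsMinusculeInt m' ∧
      rootSystem.coreflection r (castVec m) = castVec m' ∧
      castVec m' - castVec m ∈ AffineWeyl.corootLattice rootSystem := fun r m hm => by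
    refine ⟨_, hm.reflect r.2, coreflection_castVec r m, ?_⟩
    rw [castVec_sub_smul, sub_sub_cancel_left, Int.cast_smul_eq_zsmul]
    exact neg_mem (zsmul_mem (coroot_mem r) _)
  induction hw using Subgroup.closure_induction'' generalizing m with
  | one => exact ⟨m, hm, rfl, by simp⟩
  | mem s hs => obtain ⟨r, rfl⟩ := hs; exact refl r hm
  | inv_mem s hs =>
    obtain ⟨r, rfl⟩ := hs
    rw [rootSystem.coreflection_inv]
    exact refl r hm
  | mul g h _ _ hg hh =>
    obtain ⟨m1, h1, h2, h3⟩ := hh hm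
    obtain ⟨m2, h4, h5, h6⟩ := hg h1
    refine ⟨m2, h4, by rw [LinearEquiv.mul_apply, h2, h5], ?_⟩
    rw [← sub_add_sub_cancel]
    exact add_mem h6 h3

/-! ### The element `x` -/

theorem s_apply (i : ℕ) (v : Vec) : s i v =
    v - v (Fin.ofNat 7 (i - 1)) • castVec (cor (Pi.single (Fin.ofNat 7 (i - 1)) 1)) := by
  rw [s, refl_apply]
  simp only [simpleRoot, castVec_single_dot]

theorem s1_apply (v : Vec) : s 1 v = ![-v 0, v 1, v 2 + v 0, v 3, v 4, v 5, v 6] := by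
  rw [s_apply, cor, mulVec_eq]; funext j
  fin_cases j <;> (simp [castVec, Fin.ofNat]; try ring)

theorem s2_apply (v : Vec) : s 2 v = ![v 0, -v 1, v 2, v 3 + v 1, v 4, v 5, v 6] := by
  rw [s_apply, cor, mulVec_eq]; funext j
  fin_cases j <;> (simp [castVec, Fin.ofNat]; try ring)

theorem s3_apply (v : Vec) : s 3 v = ![v 0 + v 2, v 1, -v 2, v 3 + v 2, v 4, v 5, v 6] := by
  rw [s_apply, cor, mulVec_eq]; funext j
  fin_cases j <;> (simp [castVec, Fin.ofNat]; try ring)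

theorem s4_apply (v : Vec) :
    s 4 v = ![v 0, v 1 + v 3, v 2 + v 3, -v 3, v 4 + v 3, v 5, v 6] := by
  rw [s_apply, cor, mulVec_eq]; funext j
  fin_cases j <;> (simp [castVec, Fin.ofNat]; try ring)

theorem s5_apply (v : Vec) : s 5 v = ![v 0, v 1, v 2, v 3 + v 4, -v 4, v 5 + v 4, v 6] := by
  rw [s_apply, cor, mulVec_eq]; funext j
  fin_cases j <;> (simp [castVec, Fin.ofNat]; try ring)

theorem s6_apply (v : Vec) : s 6 v = ![v 0, v 1, v 2, v 3, v 4 + v 5, -v 5, v 6 + v 5] := by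
  rw [s_apply, cor, mulVec_eq]; funext j
  fin_cases j <;> (simp [castVec, Fin.ofNat]; try ring)

theorem s7_apply (v : Vec) : s 7 v = ![v 0, v 1, v 2, v 3, v 4, v 5 + v 6, -v 6] := by
  rw [s_apply, cor, mulVec_eq]; funext j
  fin_cases j <;> (simp [castVec, Fin.ofNat]; try ring)

theorem refl_inv (r : Root) : (AffineWeyl.refl rootSystem r)⁻¹ = AffineWeyl.refl rootSystem r := by
  rw [← affRefl_zero, affRefl_inv]

theorem s_inv (i : ℕ) : (s i)⁻¹ = s i := refl_inv _

/-- Here and in the next four lemmas, the words for w₁⁻¹ and w₂ are cut into short pieces whose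
composition with t_μ gives `x_apply`. -/
theorem word1_apply (v : Vec) : (s 3 * s 5 * s 4 * s 2) v =
    ![v 0 + v 1 + v 2 + v 3, v 3, -v 1 - v 2 - v 3, v 1 + v 2 + v 3 + v 4, -v 1 - v 3 - v 4, v 1 + v 3 + v 4 + v 5, v 6] := by
  simp only [mul_apply', s2_apply, s3_apply, s4_apply, s5_apply, Matrix.cons_val]
  funext j
  fin_cases j <;> simp <;> ring

theorem word2_apply (v : Vec) : (s 2 * s 3 * s 1 * s 4) v =
    ![v 2 + v 3, -v 1 - v 3, -v 0 - v 2 - v 3, v 0 + v 1 + v 2 + v 3, v 3 + v 4, v 5, v 6] := by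
  simp only [mul_apply', s1_apply, s2_apply, s3_apply, s4_apply, Matrix.cons_val]
  funext j
  fin_cases j <;> simp <;> ring

theorem word3_apply (v : Vec) : (s 7 * s 6 * s 5 * s 4) v =
    ![v 0, v 1 + v 3, v 2 + v 3, v 4, v 5, v 6, -v 3 - v 4 - v 5 - v 6] := by
  simp only [mul_apply', s4_apply, s5_apply, s6_apply, s7_apply, Matrix.cons_val]
  funext j
  fin_cases j <;> simp <;> ring

theorem word4_apply (v : Vec) : (s 4 * s 1 * s 3) v =
    ![-v 0 - v 2, v 1 + v 2 + v 3, v 0 + v 2 + v 3, -v 2 - v 3, v 2 + v 3 + v 4, v 5, v 6] := by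
  simp only [mul_apply', s1_apply, s3_apply, s4_apply, Matrix.cons_val]
  funext j
  fin_cases j <;> simp <;> ring

theorem word5_apply (v : Vec) : (s 4 * s 3 * s 2) v =
    ![v 0 + v 2, v 2 + v 3, v 1 + v 3, -v 1 - v 2 - v 3, v 1 + v 2 + v 3 + v 4, v 5, v 6] := by
  simp only [mul_apply', s2_apply, s3_apply, s4_apply, Matrix.cons_val]
  funext j
  fin_cases j <;> simp <;> ring

theorem x_apply (v : Vec) : x v =
    ![v 2, v 4, v 0, -v 0 - v 2 - v 3 - v 4, v 0 + v 1 + 2 * v 2 + 3 * v 3 + 2 * v 4 + v 5, v 6,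
      1 - v 0 - 2 * v 1 - 2 * v 2 - 3 * v 3 - 2 * v 4 - v 5 - v 6] := by
  have h : x v = (s 4 * s 3 * s 2) ((s 4 * s 1 * s 3) (rho7 +
      (s 7 * s 6 * s 5 * s 4) ((s 2 * s 3 * s 1 * s 4) ((s 3 * s 5 * s 4 * s 2) v)))) := by
    simp only [x, w₁, w₂, mul_inv_rev, s_inv, mul_apply', trans_apply]
  rw [h, word1_apply, word2_apply, word3_apply, word4_apply, word5_apply, rho7]
  funext j
  fin_cases j <;> simp <;> ring

/-! ### Non-admissibility -/

theorem x_basePoint : (18 : ℝ) • x basePoint = castVec ![1, 1, 1, -4, 10, 1, 6] := by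
  rw [x_apply]
  funext j
  fin_cases j <;> simp [castVec, basePoint] <;> norm_num

theorem translation_basePoint (m : Fin 7 → ℤ) :
    (18 : ℝ) • AffineWeyl.trans (castVec m) basePoint = castVec (1 + (18 : ℤ) • m) := by
  rw [trans_apply]
  funext j
  simp [castVec, basePoint]
  ring

theorem IsMinusculeInt.inHull {m : Fin 7 → ℤ} (hm : IsMinusculeInt m) :
    InHull (1 + (18 : ℤ) • m) := by
  intro r hr
  have h1 : r ⬝ᵥ (1 + (18 : ℤ) • m) - height r = 18 * (r ⬝ᵥ m) := by
    rw [dotProduct_add, dotProduct_smul, dot_eq r 1, height, smul_eq_mul]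
    simp
  rw [h1, abs_mul]
  have := hm r hr
  norm_num
  linarith

theorem x_not_mem_adm : x ∉ Adm rho7 := by
  rintro ⟨-, w, hw, ω, hω, y, -, y', -, hx, ht, hle⟩
  obtain ⟨m, hm, hm', -⟩ := weyl_castVec hw isMinusculeInt_rho7
  rw [castVec_rho7] at hm'
  have hω' : ω basePoint ∈ baseAlcove := by
    have h := Set.mem_image_of_mem ω basePoint_mem
    rwa [hω.2] at h
  have hp := hx ▸ x_basePoint
  have hq := translation_basePoint m
  rw [← hm', ht] at hq
  have h := isUpper_base.of_chain (chain_of_bruhatLE hle hω' hp hq) hm.inHull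
  exact h.not_translation m fun i => by simp

/-! ### Permissibility -/

theorem castVec_cor_mem (c : Fin 7 → ℤ) :
    castVec (cor c) ∈ AffineWeyl.corootLattice rootSystem := by
  have h : castVec (cor c) = ∑ i, c i • castVec (cor (Pi.single i 1)) := by
    funext j
    simp [castVec, cor, Matrix.mulVec, dotProduct, mul_comm]
  rw [h]
  exact sum_mem fun i _ => zsmul_mem (coroot_mem (simpleRoot i)) _

/-- The extended affine Weyl group of `E₇`. -/
noncomputable abbrev extWeyl : Subgroup (Vec ≃ᵃ[ℝ] Vec) := AffineWeyl.extAffineWeyl rootSystem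

theorem refl_mem_extWeyl (r : Root) : AffineWeyl.refl rootSystem r ∈ extWeyl :=
  ⟨coreflection_mem r, by
    rw [refl_apply, dotProduct_zero, zero_smul, sub_zero]; exact zero_mem _⟩

theorem trans_mem_extWeyl (m : Fin 7 → ℤ) : AffineWeyl.trans (castVec m) ∈ extWeyl :=
  ⟨one_mem _, by rw [trans_apply, add_zero]; exact castVec_mem_coweightLattice m⟩

theorem trans_rho7_mem_extWeyl : AffineWeyl.trans rho7 ∈ extWeyl :=
  castVec_rho7 ▸ trans_mem_extWeyl _

theorem s_mem_extWeyl (i : ℕ) : s i ∈ extWeyl := refl_mem_extWeyl _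

theorem x_mem_extWeyl : x ∈ extWeyl := by
  have h := s_mem_extWeyl
  have h1 : w₁ ∈ extWeyl := by
    unfold w₁
    repeat' first | exact h _ | apply mul_mem
  have h2 : w₂ ∈ extWeyl := by
    unfold w₂
    repeat' first | exact h _ | apply mul_mem
  exact mul_mem (mul_mem h2 trans_rho7_mem_extWeyl) (inv_mem h1)

theorem isRoot_of_any {a : NatVec} (h : posRoots.any a.beq = true) : IsRoot a.toRoot := by
  simp only [List.any_eq_true] at h
  obtain ⟨b, hb, h⟩ := h
  rw [NatVec.eq_of_beq h]
  exact isRoot_toRoot hb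

/-- The nontrivial element of `Ω`, as the translation by `ρ₇` after the product of the reflections
in three orthogonal roots. -/
noncomputable def omega : Vec ≃ᵃ[ℝ] Vec :=
  AffineWeyl.trans rho7 *
    (AffineWeyl.refl rootSystem
        ⟨_, isRoot_of_any (a := ⟨0, 1, 1, 2, 2, 2, 1⟩) (by decide +kernel)⟩ *
      (AffineWeyl.refl rootSystem
          ⟨_, isRoot_of_any (a := ⟨1, 1, 1, 2, 2, 1, 1⟩) (by decide +kernel)⟩ *
        AffineWeyl.refl rootSystem
          ⟨_, isRoot_of_any (a := ⟨1, 1, 2, 2, 1, 1, 1⟩) (by decide +kernel)⟩))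

theorem omega_mem_extWeyl : omega ∈ extWeyl :=
  mul_mem trans_rho7_mem_extWeyl (mul_mem (refl_mem_extWeyl _)
    (mul_mem (refl_mem_extWeyl _) (refl_mem_extWeyl _)))

theorem castVec_dot_eq (r : Fin 7 → ℤ) (v : Vec) : castVec r ⬝ᵥ v =
    r 0 * v 0 + r 1 * v 1 + r 2 * v 2 + r 3 * v 3 + r 4 * v 4 + r 5 * v 5 + r 6 * v 6 := by
  simp [castVec, dotProduct, Fin.sum_univ_succ]; ring

theorem omega_apply (v : Vec) : omega v =
    ![v 5, v 1, v 4, v 3, v 2, v 0,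
      1 - (2 * v 0 + 2 * v 1 + 3 * v 2 + 4 * v 3 + 3 * v 4 + 2 * v 5 + v 6)] := by
  simp only [omega, mul_apply', trans_apply, refl_apply, rho7, castVec_dot_eq, cor, mulVec_eq,
    NatVec.toRoot]
  funext j
  fin_cases j <;> (simp [castVec]; try ring)

theorem theta_dot (v : Vec) : castVec theta ⬝ᵥ v =
    2 * v 0 + 2 * v 1 + 3 * v 2 + 4 * v 3 + 3 * v 4 + 2 * v 5 + v 6 := by
  rw [castVec_dot_eq]; simp [theta]

theorem omega_mul_self : omega * omega = 1 := by
  ext1 v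
  rw [mul_apply', omega_apply, omega_apply]
  funext j
  fin_cases j <;> simp <;> ring

theorem omega_mem_baseAlcove {v : Vec} (hv : v ∈ baseAlcove) : omega v ∈ baseAlcove := by
  rw [mem_baseAlcove, theta_dot] at *
  obtain ⟨h1, h2⟩ := hv
  rw [omega_apply]
  constructor
  · intro i
    fin_cases i
    exacts [h1 5, h1 1, h1 4, h1 3, h1 2, h1 0, sub_pos.2 h2]
  · have := h1 6
    simp
    linarith

theorem omega_mem_Omega : omega ∈ AffineWeyl.Omega rootSystem simpleRoot highestRoot := by
  refine ⟨omega_mem_extWeyl, Set.Subset.antisymm ?_ ?_⟩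
  · rintro _ ⟨v, hv, rfl⟩
    exact omega_mem_baseAlcove hv
  · exact fun v hv => ⟨omega v, omega_mem_baseAlcove hv, by
      rw [← mul_apply', omega_mul_self]; rfl⟩

/-- Since ω(0) = ρ₇, the translation part of g ω is g(ρ₇), and only its class modulo the coroot
lattice matters. As ω² = 1, the conclusion says that g has Ω-component ω. -/
theorem mul_omega_mem_affineWeyl {g : Vec ≃ᵃ[ℝ] Vec} (hg : g ∈ extWeyl) {c : Fin 7 → ℤ}
    (h : g rho7 = castVec (cor c)) : g * omega ∈ AffineWeyl.affineWeyl rootSystem := by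
  refine ⟨(mul_mem hg omega_mem_extWeyl).1, ?_⟩
  have h0 : omega 0 = rho7 := by
    rw [omega_apply]; funext j; fin_cases j <;> simp [rho7]
  rw [mul_apply', h0, h]
  exact castVec_cor_mem c

theorem x_mul_omega_mem : x * omega ∈ AffineWeyl.affineWeyl rootSystem := by
  -- Here x(ρ₇) = ρ₆, written in simple coroots.
  have h : x rho7 = castVec (cor ![2, 3, 4, 6, 5, 4, 2]) := by
    rw [x_apply, cor, mulVec_eq]
    funext j
    fin_cases j <;> simp [rho7, castVec]
  have h' := x_mem_extWeyl
  generalize x = g at *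
  exact mul_omega_mem_affineWeyl h' h

theorem trans_mul_omega_mem :
    AffineWeyl.trans rho7 * omega ∈ AffineWeyl.affineWeyl rootSystem := by
  -- These are the coefficients of 2ρ₇ in simple coroots.
  refine mul_omega_mem_affineWeyl trans_rho7_mem_extWeyl (c := ![2, 3, 4, 6, 5, 4, 3]) ?_
  rw [trans_apply, cor, mulVec_eq]
  funext j
  fin_cases j <;> (simp [rho7, castVec]; try norm_num)

theorem closure_baseAlcove_subset {v : Vec} (hv : v ∈ closure baseAlcove) :
    (∀ i, 0 ≤ v i) ∧ castVec theta ⬝ᵥ v ≤ 1 := by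
  have hc : IsClosed {v : Vec | (∀ i, 0 ≤ v i) ∧ castVec theta ⬝ᵥ v ≤ 1} := by
    simp only [theta_dot, Set.ofPred_and, Set.ofPred_forall]
    refine (isClosed_iInter fun i => isClosed_le continuous_const (continuous_apply i)).inter
      (isClosed_le ?_ continuous_const)
    fun_prop
  refine closure_minimal (fun u hu => ?_) hc hv
  rw [mem_baseAlcove] at hu
  exact ⟨fun i => (hu.1 i).le, hu.2.le⟩

/-- A criterion for minuscule coweights that can be decided. -/
theorem isMinusculeInt_of_all {m : Fin 7 → ℤ}
    (h : ∀ a ∈ posRoots, (a.toRoot ⬝ᵥ m).natAbs ≤ 1) : IsMinusculeInt m := by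
  refine isMinusculeInt_of_posRoots ?_
  rintro r ⟨a, ha, rfl⟩
  have := h a ha
  rw [abs_le]; omega

/-- Weights in the orbit of `ρ₇` whose convex combinations give `x v - v` for `v` in the closed
alcove. -/
def hullPoints : Fin 8 → Fin 7 → ℤ :=
  ![![0, 0, 0, 0, 0, 0, 1], ![-1, 0, 1, -1, 1, 0, 0], ![-1, -1, 0, 1, 0, 0, 0],
    ![1, 0, 0, -1, 1, 0, 0], ![0, 0, -1, 0, 1, 0, 0], ![1, 1, -1, 0, 0, 0, 0],
    ![0, 0, 0, 0, 1, -1, 0], ![0, 0, 0, 0, 0, 1, -1]]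

theorem hullPoints_mem (i : Fin 8) :
    castVec (hullPoints i) ∈ AffineWeyl.orbit rootSystem rho7 := by
  refine castVec_mem_orbit (isMinusculeInt_of_all ?_) ?_
  · revert i
    decide +kernel
  · revert i
    decide +kernel

theorem x_sub_mem_convexHull {v : Vec} (hv : v ∈ closure baseAlcove) :
    x v - v ∈ convexHull ℝ (AffineWeyl.orbit rootSystem rho7) := by
  obtain ⟨h0, h1⟩ := closure_baseAlcove_subset hv
  rw [theta_dot] at h1
  -- The first coefficient is at least 1 - ⟨θ, v⟩ ≥ 0, the others are sums of coordinates of v, and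
  -- all eight add up to 1.
  let c : Fin 8 → ℝ := ![1 - v 0 - 2 * v 1 - 2 * v 2 - 3 * v 3 - 2 * v 4 - v 5 - v 6,
    v 0 + v 3 + v 4, v 1, v 1 + v 2 + v 3, v 2 + v 3, v 4, v 5, v 6]
  have h2 : x v - v = ∑ i, c i • castVec (hullPoints i) := by
    rw [x_apply]
    funext j
    rw [Finset.sum_apply]
    fin_cases j <;> simp [Fin.sum_univ_succ, c, hullPoints, castVec] <;> ring
  rw [h2]
  have a0 := h0 0
  have a1 := h0 1
  have a2 := h0 2
  have a3 := h0 3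
  have a4 := h0 4
  have a5 := h0 5
  have a6 := h0 6
  refine (convex_convexHull ℝ _).sum_mem (fun i _ => ?_) ?_
    fun i _ => subset_convexHull ℝ _ (hullPoints_mem i)
  · fin_cases i <;> simp [c] <;> linarith
  · simp [Fin.sum_univ_succ, c]
    ring

theorem mem_perm_rho7 {g : Vec ≃ᵃ[ℝ] Vec} (hg : g ∈ extWeyl)
    (hg' : g * omega ∈ AffineWeyl.affineWeyl rootSystem)
    (h : ∀ v ∈ closure baseAlcove, g v - v ∈ convexHull ℝ (AffineWeyl.orbit rootSystem rho7)) :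
    g ∈ Perm rho7 := by
  refine ⟨hg, ⟨omega, omega_mem_Omega, _, hg', _, trans_mul_omega_mem, ?_, ?_⟩, h⟩
  · rw [mul_assoc, omega_mul_self, mul_one]
  · rw [mul_assoc, omega_mul_self, mul_one]

theorem x_mem_perm : x ∈ Perm rho7 := by
  have h1 := x_mem_extWeyl
  have h2 := x_mul_omega_mem
  have h3 := fun v => x_sub_mem_convexHull (v := v)
  generalize x = g at *
  exact mem_perm_rho7 h1 h2 h3

/-! ### Invariance under the Weyl group -/

theorem adm_weyl {w : Vec ≃ₗ[ℝ] Vec} (hw : w ∈ weyl) (μ : Vec) : Adm μ ⊆ Adm (w μ) := by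
  rintro z ⟨hz, w', hw', h⟩
  refine ⟨hz, w' * w⁻¹, mul_mem hw' (inv_mem hw), ?_⟩
  rwa [LinearEquiv.mul_apply, ← LinearEquiv.mul_apply w⁻¹ w, inv_mul_cancel]

theorem orbit_weyl {w : Vec ≃ₗ[ℝ] Vec} (hw : w ∈ weyl) (μ : Vec) :
    AffineWeyl.orbit rootSystem (w μ) ⊆ AffineWeyl.orbit rootSystem μ := by
  rintro _ ⟨w', hw', rfl⟩
  exact ⟨w' * w, mul_mem hw' hw, rfl⟩

theorem perm_weyl {w : Vec ≃ₗ[ℝ] Vec} (hw : w ∈ weyl) {m : Fin 7 → ℤ} (hm : IsMinusculeInt m) :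
    Perm (w (castVec m)) ⊆ Perm (castVec m) := by
  rintro z ⟨hz, ⟨ω, hω, y₁, hy₁, y₂, hy₂, h1, h2⟩, h3⟩
  obtain ⟨m', -, hm', hQ⟩ := weyl_castVec hw hm
  -- The translations by μ and w(μ) differ by an element of the coroot lattice, so they have the
  -- same Ω-component.
  refine ⟨hz, ⟨ω, hω, y₁, hy₁, AffineWeyl.trans (castVec m - castVec m') * y₂,
    mul_mem ⟨one_mem _, ?_⟩ hy₂, h1, ?_⟩,
    fun v hv => convexHull_mono (orbit_weyl hw _) (h3 v hv)⟩
  · rw [trans_apply, add_zero, ← neg_sub]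
    exact neg_mem hQ
  · rw [mul_assoc, ← h2, hm']
    ext1 v
    rw [mul_apply', trans_apply, trans_apply, trans_apply]
    abel

theorem adm_ne_perm {μ : Vec} (hμ : μ ∈ AffineWeyl.coweightLattice rootSystem)
    (hmin : AffineWeyl.IsMinuscule rootSystem μ) (h0 : μ ≠ 0) : Adm μ ≠ Perm μ := by
  obtain ⟨m, rfl⟩ := exists_castVec hμ
  rw [isMinuscule_castVec] at hmin
  obtain ⟨w, hw, hw'⟩ := exists_weyl_eq_rho7 hmin fun h => h0 (funext fun i => by simp [castVec, h])
  intro h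
  have h1 : x ∈ Perm (castVec m) := perm_weyl hw hmin (hw' ▸ x_mem_perm)
  exact x_not_mem_adm (hw' ▸ adm_weyl hw _ (h ▸ h1))

end E7

theorem mainTheorem2 :
    (∀ μ : Fin 7 → ℝ,
      (μ ∈ AffineWeyl.coweightLattice E7.rootSystem ∧
        AffineWeyl.IsMinuscule E7.rootSystem μ ∧
        AffineWeyl.IsDominant E7.rootSystem E7.simpleRoot μ ∧ μ ≠ 0) ↔ μ = E7.rho7) ∧
    E7.x ∈ E7.Perm E7.rho7 ∧
    E7.x ∉ E7.Adm E7.rho7 ∧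
    ∀ μ ∈ AffineWeyl.coweightLattice E7.rootSystem,
      AffineWeyl.IsMinuscule E7.rootSystem μ → μ ≠ 0 → E7.Adm μ ≠ E7.Perm μ :=
  ⟨E7.unique_minuscule, E7.x_mem_perm, E7.x_not_mem_adm, fun _ h1 h2 h3 =>
    E7.adm_ne_perm h1 h2 h3⟩
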